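/- Let $U=[-1,1]^{\mathbb N}$ carry the product topology and the measure $\mu=\bigotimes_{j\in\mathbb N}\frac{\lambda}{2}$ ($\lambda$ the Lebesgue measure on $[-1,1]$). For $r>0$, $S\subseteq\mathbb C$ let $\mathcal B_r(S)=\{z\in\mathbb C:\exists y\in S,\ |z-y|<r\}$, $\mathcal B_r=\mathcal B_r(\{0\})$, $\mathcal B_r(1)=\mathcal B_r(\{1\})$; for $\boldsymbol\delta\in(0,\infty)^k$ and $j\le k$ let $\boldsymbol\delta_{[j]}=(\delta_i)_{i=1}^j$, $\mathcal B_{\boldsymbol\delta}(S)=\prod_{i=1}^k\mathcal B_{\delta_i}(S)$, $\mathcal B_{\boldsymbol\delta}=\mathcal B_{\boldsymbol\delta}(\{0\})$ and $\mathcal B_{\boldsymbol\delta}([-1,1])\times U=\prod_{i\le k}\mathcal B_{\delta_i}([-1,1])\times\prod_{i>k}[-1,1]\subset\mathbb C^{\mathbb N}$. For a continuous positive probability density $f$ on $U$ (with respect to $\mu$) let $\hat f_0=1$, $\hat f_n(\boldsymbol x)=\int_U f(\boldsymbol x,\boldsymbol t)\,\mu(d\boldsymbol t)$ for $\boldsymbol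 x\in[-1,1]^n$, $f_n(\boldsymbol x)=\hat f_n(\boldsymbol x)/\hat f_{n-1}(\boldsymbol x_{[n-1]})$ and $F_{n}(\boldsymbol x_{[n-1]},x_n)=\int_{-1}^{x_n}f_n(\boldsymbol x_{[n-1]},t)\,\frac{dt}{2}$. For two such densities $f_\rho$, $f_\pi$, with conditional distribution functions $F_{\rho;n}$, $F_{\pi;n}$, the Knothe--Rosenblatt transport $T=(T_n)_{n\in\mathbb N}$ is given recursively by $T_n(\boldsymbol x_{[n-1]},\cdot)=F_{\pi;n}(T_1(x_1),\dots,T_{n-1}(\boldsymbol x_{[n-1]}),\cdot)^{-1}\circ F_{\rho;n}(\boldsymbol x_{[n-1]},\cdot)$ on $[-1,1]$. **Theorem.** Let $0<\tilde M\le\tilde L<\infty$. There exist $\tilde C_6,\tilde C_7\in(0,1]$ and $\tilde C_8>0$, depending only on $\tilde M$ and $\tilde L$, such that the following holds for all $k\in\mathbb N$ and $\boldsymbol\delta\in(0,\infty)^k$. Suppose that for $*\in\{\rho,\pi\}$: (a) $f_*:\mathcal B_{\boldsymbol\delta}([-1,1])\times U\to\mathbb C$ is continuous; (b) $f_*$ restricted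 to $U$ is a positive probability density, and $f_*(\cdot,\boldsymbol y)$ is holomorphic on $\mathcal B_{\boldsymbol\delta}([-1,1])$ for every $\boldsymbol y\in U$; (c) $\tilde M\le|f_*(\boldsymbol x)|\le\tilde L$ for all $\boldsymbol x\in\mathcal B_{\boldsymbol\delta}([-1,1])\times U$; (d) $\sup_{\boldsymbol y\in\mathcal B_{\boldsymbol\delta}\times\{0\}^{\mathbb N}}|f_*(\boldsymbol x+\boldsymbol y)-f_*(\boldsymbol x)|\le\tilde C_6$ for all $\boldsymbol x\in U$; (e) $\sup_{\boldsymbol y\in\mathcal B_{\boldsymbol\delta_{[j]}}\times\{0\}^{\mathbb N}}|f_*(\boldsymbol x+\boldsymbol y)-f_*(\boldsymbol x)|\le\tilde C_6\,\delta_{j+1}$ for all $\boldsymbol x\in U$ and $j\in\{1,\dots,k-1\}$. Let $T$ be the Knothe--Rosenblatt transport for $f_\rho,f_\pi$ and $\zeta_j=\tilde C_7\delta_j$ for $j\in\{1,\dots,k\}$. Then for every $j\in\{1,\dots,k\}$ the partial derivative $R_j=\partial_{x_j}T_j$ exists on $[-1,1]^j$ and extends to a holomorphic function $R_j:\mathcal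 B_{\boldsymbol\zeta_{[j]}}([-1,1])\to\mathcal B_{\tilde C_8}(1)$ with $\Re R_j(\boldsymbol x)\ge 1/\tilde C_8$ for all $\boldsymbol x\in\mathcal B_{\boldsymbol\zeta_{[j]}}([-1,1])$; moreover, if $j\ge2$, then $R_j$ maps $\mathcal B_{\boldsymbol\zeta_{[j-1]}}([-1,1])\times[-1,1]$ into $\mathcal B_{\tilde C_8/\delta_j}(1)$. -/

import Mathlib

open MeasureTheory

noncomputable section

namespace KnotheRosenblatt

/-- The real interval `[-1,1]`, seen inside `ℂ`. -/
def realSeg : Set ℂ := (fun x : ℝ => (x : ℂ)) '' Set.Icc (-1) 1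

/-- The real cube `U = [-1,1]^ℕ`. Coordinates are numbered from `0`. -/
def cube : Set (ℕ → ℝ) := {x | ∀ i, x i ∈ Set.Icc (-1 : ℝ) 1}

/-- Coordinatewise embedding of real vectors (or sequences) into complex ones. -/
def toC {ι : Type*} (x : ι → ℝ) : ι → ℂ := fun i => (x i : ℂ)

/-- The sequence `(z, y)`: the vector `z` followed by the sequence `y`. -/
def concat {α : Type*} {n : ℕ} (z : Fin n → α) (y : ℕ → α) : ℕ → α :=
  fun i => if h : i < n then z ⟨i, h⟩ else y (i - n)

/-- `B_ρ([-1,1]) = ∏_i B_{ρ_i}([-1,1]) ⊆ ℂⁿ`, the product of the open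
`ρ_i`-neighbourhoods of `[-1,1]` in `ℂ`. -/
def nbhdBox {n : ℕ} (ρ : Fin n → ℝ) : Set (Fin n → ℂ) :=
  {z | ∀ i, z i ∈ Metric.thickening (ρ i) realSeg}

/-- `B_ρ([-1,1]) × U ⊆ ℂ^ℕ`. -/
def nbhdBoxTimesCube {k : ℕ} (ρ : Fin k → ℝ) : Set (ℕ → ℂ) :=
  {w | (∀ i : Fin k, w i ∈ Metric.thickening (ρ i) realSeg) ∧ ∀ i, k ≤ i → w i ∈ realSeg}

/-- `B_{ρ_[j]} × {0}^ℕ ⊆ ℂ^ℕ`: the first `j` entries lie in the open discs of radii `ρ_i`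
around `0`, the others vanish. Used for `j ≤ k`. -/
def discBoxTimesZero {k : ℕ} (ρ : Fin k → ℝ) (j : ℕ) : Set (ℕ → ℂ) :=
  {y | (∀ i : Fin k, (i : ℕ) < j → ‖y i‖ < ρ i) ∧ ∀ i, j ≤ i → y i = 0}

/-- The uniform probability measure `λ/2` on `[-1,1]`, as a measure on `ℝ`. -/
def unif : Measure ℝ := (2⁻¹ : ENNReal) • volume.restrict (Set.Icc (-1) 1)

instance : IsProbabilityMeasure unif := by
  constructor
  have h : (1 : ℝ) - -1 = 2 := by norm_num
  simp only [unif, Measure.smul_apply, Measure.restrict_apply_univ, Real.volume_Icc, h,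
    smul_eq_mul]
  rw [ENNReal.ofReal_ofNat]
  exact ENNReal.inv_mul_cancel (by norm_num) (by norm_num)

/-- The uniform measure `μ` on `U`: the infinite product of the measures `λ/2` on `[-1,1]`
(as a measure on `ℝ^ℕ` carried by `U`). -/
def unifCube : Measure (ℕ → ℝ) := Measure.infinitePi fun _ => unif

/-- The real function on `U` obtained by restricting `f`. -/
def realRestr (f : (ℕ → ℂ) → ℂ) : (ℕ → ℝ) → ℝ := fun x => (f (toC x)).re

/-- `f` restricts to a positive probability density with respect to `μ` on `U`. -/
structure IsDensityOnCube (f : (ℕ → ℂ) → ℂ) : Prop where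
  real : ∀ x ∈ cube, (f (toC x)).im = 0
  pos : ∀ x ∈ cube, 0 < (f (toC x)).re
  integrable : Integrable (realRestr f) unifCube
  integral_eq_one : ∫ x, realRestr f x ∂unifCube = 1

/-- The marginal `f̂_n(x) = ∫_U f(x, t) μ(dt)` in the first `n` variables.
For `n = 0` this is the total mass, i.e. `1` for a probability density. -/
def marginal (f : (ℕ → ℝ) → ℝ) (n : ℕ) (x : Fin n → ℝ) : ℝ :=
  ∫ t, f (concat x t) ∂unifCube

/-- The conditional density `f̂_{n+1}(x, s) / f̂_n(x)` of the variable number `n` (counted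
from `0`), given the previous ones. -/
def condDensity (f : (ℕ → ℝ) → ℝ) (n : ℕ) (x : Fin n → ℝ) (s : ℝ) : ℝ :=
  marginal f (n + 1) (Fin.snoc x s) / marginal f n x

/-- The distribution function `s ↦ ∫_{-1}^s f_n(x, t) dt/2` of the conditional density. -/
def condCDF (f : (ℕ → ℝ) → ℝ) (n : ℕ) (x : Fin n → ℝ) (s : ℝ) : ℝ :=
  ∫ t in (-1 : ℝ)..s, condDensity f n x t / 2

/-- The first `n` components of the Knothe–Rosenblatt transport `T` from the density `f` to
the density `g`, as a function of the first `n` variables: the new component is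
`G(T_0, …, T_{n-1}, ·)⁻¹ (F(x_0, …, x_{n-1}, x_n))`, where `F`, `G` are the conditional
distribution functions and the inverse is that of a map on `[-1,1]`. -/
def transport (f g : (ℕ → ℝ) → ℝ) : (n : ℕ) → (Fin n → ℝ) → (Fin n → ℝ)
  | 0, x => x
  | n + 1, x =>
      Fin.snoc (transport f g n (Fin.init x))
        (Function.invFunOn (condCDF g n (transport f g n (Fin.init x))) (Set.Icc (-1) 1)
          (condCDF f n (Fin.init x) (x (Fin.last n))))

/-- The component of the transport with number `j` (counted from `0`), a function of the
variables `x_0, …, x_j`. -/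
def transportComp (f g : (ℕ → ℝ) → ℝ) (j : ℕ) (x : Fin (j + 1) → ℝ) : ℝ :=
  transport f g (j + 1) x (Fin.last j)

/-- The assumptions on a density, for given `M`, `L`, smallness constant `C` and `δ`. -/
structure Admissible (M L C : ℝ) {k : ℕ} (δ : Fin k → ℝ) (f : (ℕ → ℂ) → ℂ) : Prop where
  continuousOn : ContinuousOn f (nbhdBoxTimesCube δ)
  density : IsDensityOnCube f
  holomorphic : ∀ y ∈ cube,
    DifferentiableOn ℂ (fun z : Fin k → ℂ => f (concat z (toC y))) (nbhdBox δ)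
  lower : ∀ w ∈ nbhdBoxTimesCube δ, M ≤ ‖f w‖
  upper : ∀ w ∈ nbhdBoxTimesCube δ, ‖f w‖ ≤ L
  small : ∀ x ∈ cube, ∀ y ∈ discBoxTimesZero δ k, ‖f (toC x + y) - f (toC x)‖ ≤ C
  small_next : ∀ j : ℕ, 1 ≤ j → ∀ hj : j < k, ∀ x ∈ cube, ∀ y ∈ discBoxTimesZero δ j,
    ‖f (toC x + y) - f (toC x)‖ ≤ C * δ ⟨j, hj⟩

/-- `R` extends the partial derivative `∂_{x_j} T_j`, defined on the real cube `[-1,1]^{j+1}`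
(one-sided derivative where `x_j = ±1`), for a function `T_j` of `x_0, …, x_j`. -/
def ExtendsLastPartial {j : ℕ} (T : (Fin (j + 1) → ℝ) → ℝ) (R : (Fin (j + 1) → ℂ) → ℂ) :
    Prop :=
  ∀ x : Fin (j + 1) → ℝ, (∀ i, x i ∈ Set.Icc (-1 : ℝ) 1) →
    ∃ r : ℝ, R (toC x) = (r : ℂ) ∧
      HasDerivWithinAt (fun t : ℝ => T (Function.update x (Fin.last j) t)) r
        (Set.Icc (-1) 1) (x (Fin.last j))

end KnotheRosenblatt

end

/-!
Put `m = M / L` and `Λ = L / M`. Quotients of marginals extend the conditional densities of an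
admissible density holomorphically, and smallness keeps their values within `m / 4` of `[m, Λ]`.
Hence each conditional distribution function, continued to a convex neighbourhood of `[-1,1]`, is
close to a multiple of the identity: it expands distances by at least `3 m / 8` and at most `Λ`, and
its image of a disc contains a disc of comparable radius. So the equation defining the next
component of the transport stays uniquely solvable at a complex point, with a solution near the
value of the real transport at a nearby real point, and the implicit function theorem makes the
solution holomorphic.

The induction over the components loses no constants: once the earlier components have stayed in
their neighbourhoods, they move the next density by at most `m / 64 * min 1 (δ n)`, however they
got there, which is where the factor `δ ⟨j, hj⟩` in `small_next` enters.

The last partial derivative is the quotient of the two conditional densities. Both have mean `1`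
on `[-1,1]` and are bounded on a neighbourhood of radius `δ n`, so Cauchy's estimate puts them
within a multiple of `1 / δ n` of `1` near `[-1,1]`.
-/

noncomputable section

namespace KnotheRosenblatt

open Set Filter Topology Metric

/-! ### Holomorphic functions with values in a normed space -/

lemma norm_sub_le_of_differentiableOn_ball {E F : Type*} [NormedAddCommGroup E] [NormedSpace ℂ E]
    [NormedAddCommGroup F] [NormedSpace ℂ F] {f : E → F} {c z : E} {r B : ℝ}
    (hf : DifferentiableOn ℂ f (ball c r)) (hB : ∀ w ∈ ball c r, ‖f w‖ ≤ B) (hz : z ∈ ball c r) :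
    ‖f z - f c‖ ≤ 2 * B / r * ‖z - c‖ := by
  have hc : c ∈ ball c r := mem_ball_self (nonempty_ball.1 ⟨z, hz⟩)
  have hmaps : MapsTo f (ball c r) (closedBall (f c) (2 * B)) := fun w hw =>
    mem_closedBall_iff_norm.2 ((norm_sub_le _ _).trans (by linarith [hB w hw, hB c hc]))
  simpa only [dist_eq_norm] using Complex.dist_le_div_mul_dist_of_mapsTo_ball hf hmaps hz

lemma norm_sub_le_of_differentiableOn_thickening {E F : Type*} [NormedAddCommGroup E]
    [NormedSpace ℂ E] [NormedAddCommGroup F] [NormedSpace ℂ F] {f : E → F} {S : Set E} {r B : ℝ}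
    (hS : Convex ℝ S) (hf : DifferentiableOn ℂ f (thickening r S))
    (hB : ∀ z ∈ thickening r S, ‖f z‖ ≤ B) {u v : E} (hu : u ∈ thickening (r / 2) S)
    (hv : v ∈ thickening (r / 2) S) : ‖f u - f v‖ ≤ 4 * B / r * ‖u - v‖ := by
  have hball : ∀ z ∈ thickening (r / 2) S, ball z (r / 2) ⊆ thickening r S := fun z hz w hw => by
    obtain ⟨y, hy, hzy⟩ := mem_thickening_iff.1 hz
    exact mem_thickening_iff.2 ⟨y, hy, by linarith [dist_triangle w z y, mem_ball.1 hw]⟩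
  obtain ⟨y, -, huy⟩ := mem_thickening_iff.1 hu
  have hr : 0 < r / 2 := dist_nonneg.trans_lt huy
  have hB0 : 0 ≤ B := (norm_nonneg _).trans (hB u (hball u hu (mem_ball_self hr)))
  have hfderiv : ∀ z ∈ thickening (r / 2) S, ‖fderiv ℂ f z‖ ≤ 4 * B / r := fun z hz => by
    refine norm_fderiv_le_of_lip' ℂ (div_nonneg (by linarith) (by linarith)) ?_
    filter_upwards [ball_mem_nhds z hr] with w hw
    convert norm_sub_le_of_differentiableOn_ball (hf.mono (hball z hz))
      (fun w hw => hB w (hball z hz hw)) hw using 2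
    ring
  exact (hS.thickening _).norm_image_sub_le_of_norm_fderiv_le (𝕜 := ℂ)
    (fun z hz => hf.differentiableAt
      (isOpen_thickening.mem_nhds (hball z hz (mem_ball_self hr)))) hfderiv hv hu

lemma aestronglyMeasurable_fderiv_of_eventually {𝕜 E F α : Type*} [NontriviallyNormedField 𝕜]
    [CompleteSpace 𝕜] [NormedAddCommGroup E] [NormedSpace 𝕜 E] [FiniteDimensional 𝕜 E]
    [NormedAddCommGroup F] [NormedSpace 𝕜 F] [MeasurableSpace α] {μ : Measure α}
    {f : E → α → F} {z₀ : E} (hmeas : ∀ᶠ z in 𝓝 z₀, AEStronglyMeasurable (f z) μ)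
    (hdiff : ∀ᵐ a ∂μ, DifferentiableAt 𝕜 (f · a) z₀) :
    AEStronglyMeasurable (fun a => fderiv 𝕜 (f · a) z₀) μ := by
  have happly : ∀ v : E, AEStronglyMeasurable (fun a => fderiv 𝕜 (f · a) z₀ v) μ := fun v => by
    have hline : Tendsto (fun t : 𝕜 => z₀ + t • v) (𝓝[≠] 0) (𝓝 z₀) := by
      have : ContinuousAt (fun t : 𝕜 => z₀ + t • v) 0 := by fun_prop
      simpa using this.tendsto.mono_left nhdsWithin_le_nhds
    obtain ⟨u, hu, hmeas_u⟩ := exists_seq_forall_of_frequently (hline.eventually hmeas).frequently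
    refine aestronglyMeasurable_of_tendsto_ae atTop
      (f := fun n a => (u n)⁻¹ • (f (z₀ + u n • v) a - f z₀ a))
      (fun n => ((hmeas_u n).sub hmeas.self_of_nhds).const_smul _) ?_
    filter_upwards [hdiff] with a ha
    exact (hasDerivAt_iff_tendsto_slope_zero.1 (ha.hasFDerivAt.hasLineDerivAt v)).comp hu |>.congr
      fun n => by simp
  let b := Module.finBasis 𝕜 E
  have hsum : (fun a => fderiv 𝕜 (f · a) z₀) = fun a => ∑ i,
      ContinuousLinearMap.smulRightL 𝕜 E F (LinearMap.toContinuousLinearMap (b.coord i))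
        (fderiv 𝕜 (f · a) z₀ (b i)) := by
    funext a
    ext v
    conv_lhs => rw [← b.sum_repr v, map_sum]
    simp
  rw [hsum]
  exact Finset.aestronglyMeasurable_fun_sum _ fun i _ =>
    (ContinuousLinearMap.continuous _).comp_aestronglyMeasurable (happly (b i))

lemma differentiableOn_integral_of_bounded {E F α : Type*} [NormedAddCommGroup E]
    [NormedSpace ℂ E] [FiniteDimensional ℂ E] [NormedAddCommGroup F] [NormedSpace ℂ F]
    [MeasurableSpace α] {μ : Measure α} [IsFiniteMeasure μ] {s : Set E} (hs : IsOpen s)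
    {f : E → α → F} {B : ℝ} (hmeas : ∀ z ∈ s, AEStronglyMeasurable (f z) μ)
    (hdiff : ∀ᵐ a ∂μ, DifferentiableOn ℂ (f · a) s) (hB : ∀ᵐ a ∂μ, ∀ z ∈ s, ‖f z a‖ ≤ B) :
    DifferentiableOn ℂ (fun z => ∫ a, f z a ∂μ) s := by
  intro z₀ hz₀
  have hs₀ : s ∈ 𝓝 z₀ := hs.mem_nhds hz₀
  obtain ⟨r, hr, hball⟩ := Metric.isOpen_iff.1 hs z₀ hz₀
  have hdiff₀ : ∀ᵐ a ∂μ, DifferentiableAt ℂ (f · a) z₀ := hdiff.mono fun a ha =>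
    ha.differentiableAt hs₀
  refine (hasFDerivAt_integral_of_dominated_loc_of_lip' (bound := fun _ => 2 * B / r)
    (ball_mem_nhds z₀ hr) (fun z hz => hmeas z (hball hz))
    (Integrable.of_bound (hmeas z₀ hz₀) B (hB.mono fun a ha => ha z₀ hz₀))
    (aestronglyMeasurable_fderiv_of_eventually (eventually_of_mem hs₀ hmeas) hdiff₀) ?_
    (integrable_const _) (hdiff₀.mono fun a ha => ha.hasFDerivAt)).2.differentiableAt
    |>.differentiableWithinAt
  filter_upwards [hB, hdiff] with a ha hda z hz
  exact norm_sub_le_of_differentiableOn_ball (hda.mono hball) (fun w hw => ha w (hball hw)) hz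

lemma hasDerivAt_mul_integral_segment {s : Set ℂ} (hs : Convex ℝ s) (ho : IsOpen s) {g : ℂ → ℂ}
    (hg : DifferentiableOn ℂ g s) {a z : ℂ} (ha : a ∈ s) (hz : z ∈ s) :
    HasDerivAt (fun w => (w - a) * ∫ t in (0 : ℝ)..1, g (a + t * (w - a))) (g z) z := by
  obtain ⟨G, hG⟩ := hs.exists_forall_hasDerivWithinAt hg
  replace hG : ∀ w ∈ s, HasDerivAt G (g w) w := fun w hw => (hG w hw).hasDerivAt (ho.mem_nhds hw)
  have hprim : ∀ w ∈ s, (w - a) * ∫ t in (0 : ℝ)..1, g (a + t * (w - a)) = G w - G a := by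
    intro w hw
    have hmem : ∀ t ∈ uIcc (0 : ℝ) 1, a + t * (w - a) ∈ s := fun t ht => by
      rw [uIcc_of_le zero_le_one] at ht
      simpa using hs.add_smul_sub_mem ha hw ht
    have hderiv : ∀ t ∈ uIcc (0 : ℝ) 1,
        HasDerivAt (fun t : ℝ => G (a + t * (w - a))) ((w - a) * g (a + t * (w - a))) t := by
      intro t ht
      have hline : HasDerivAt (fun t : ℂ => a + t * (w - a)) (w - a) (t : ℂ) := by
        simpa using ((hasDerivAt_id (t : ℂ)).mul_const (w - a)).const_add a
      simpa [Function.comp_def, mul_comm] using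
        ((hG _ (hmem t ht)).comp (t : ℂ) hline).comp_ofReal
    have hcont : ContinuousOn (fun t : ℝ => (w - a) * g (a + t * (w - a))) (uIcc 0 1) :=
      continuousOn_const.mul (hg.continuousOn.comp (by fun_prop) hmem)
    rw [← intervalIntegral.integral_const_mul,
      intervalIntegral.integral_eq_sub_of_hasDerivAt hderiv hcont.intervalIntegrable]
    simp
  exact ((hG z hz).sub_const (G a)).congr_of_eventuallyEq
    (eventually_of_mem (ho.mem_nhds hz) hprim)

lemma differentiableAt_of_implicit {𝕜 E F G : Type*} [NontriviallyNormedField 𝕜]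
    [NormedAddCommGroup E] [NormedSpace 𝕜 E] [NormedAddCommGroup F] [NormedSpace 𝕜 F]
    [NormedAddCommGroup G] [NormedSpace 𝕜 G] {H : E × F → G} {w : E → F} {z₀ : E} {D₂ : F ≃L[𝕜] G}
    (hH : DifferentiableAt 𝕜 H (z₀, w z₀))
    (hD₂ : HasFDerivAt (fun u => H (z₀, u)) (D₂ : F →L[𝕜] G) (w z₀))
    (hw : ContinuousAt w z₀) (hconst : ∀ᶠ z in 𝓝 z₀, H (z, w z) = H (z₀, w z₀)) :
    DifferentiableAt 𝕜 w z₀ := by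
  obtain ⟨D, hD⟩ := hH
  have hDinr : ∀ u, D (0, u) = D₂ u := fun u => by
    have hsection : HasFDerivAt (fun u => H (z₀, u)) (D.comp (.inr 𝕜 E F)) (w z₀) :=
      HasFDerivAt.comp (w z₀) hD (hasFDerivAt_prodMk_right z₀ (w z₀))
    simpa using DFunLike.congr_fun (hsection.unique hD₂) u
  set w' : E →L[𝕜] F := -(D₂.symm.toContinuousLinearMap.comp (D.comp (.inl 𝕜 E F))) with hw'
  have hcurve : ∀ z, D₂.symm (D ((z, w z) - (z₀, w z₀))) = w z - w z₀ - w' (z - z₀) := fun z => by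
    have : (z, w z) - (z₀, w z₀) = (z - z₀, 0) + (0, w z - w z₀) := by simp
    rw [this, map_add, hDinr, map_add]
    simp [hw', add_comm]
  have hlittle : (fun z => w z - w z₀ - w' (z - z₀)) =o[𝓝 z₀] fun z => (z, w z) - (z₀, w z₀) := by
    have hgraph : Tendsto (fun z => (z, w z)) (𝓝 z₀) (𝓝 (z₀, w z₀)) := tendsto_id.prodMk_nhds hw
    have := ((hasFDerivAt_iff_isLittleO.1 hD).comp_tendsto hgraph).neg_left
    refine ((D₂.symm.toContinuousLinearMap.isBigO_comp _ _).trans_isLittleO this).congr' ?_ .rfl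
    filter_upwards [hconst] with z hz
    simpa [hz, -Prod.mk_sub_mk] using hcurve z
  have hbig : (fun z => (z, w z) - (z₀, w z₀)) =O[𝓝 z₀] fun z => z - z₀ := by
    have hvert : (fun z => ((0 : E), w z - w z₀ - w' (z - z₀))) =o[𝓝 z₀]
        fun z => (z, w z) - (z₀, w z₀) := (Asymptotics.isLittleO_zero _ _).prod_left hlittle
    refine hvert.right_isBigO_sub.trans (.congr_left ?_ (f₁ := fun z => (z - z₀, w' (z - z₀))) ?_)
    · exact (Asymptotics.isBigO_refl _ _).prod_left (w'.isBigO_comp _ _)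
    · intro z
      ext <;> simp
  exact (hasFDerivAt_iff_isLittleO.2 (hlittle.trans_isBigO hbig)).differentiableAt

/-! ### Cubes and boxes -/

/-- The real cube `[-1,1]ⁿ`. -/
def realCube (n : ℕ) : Set (Fin n → ℝ) := {x | ∀ i, x i ∈ Icc (-1 : ℝ) 1}

/-- The complex neighbourhood `nbhdBox` of `[-1,1]ⁿ` whose radii are the first `n` terms of the
sequence `d`. Indexing the radii by `ℕ` lets all `n` share one sequence. -/
def prefixBox (d : ℕ → ℝ) (n : ℕ) : Set (Fin n → ℂ) := nbhdBox fun i : Fin n => d i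

lemma mem_thickening_realSeg {r : ℝ} {z : ℂ} :
    z ∈ thickening r realSeg ↔ ∃ x ∈ Icc (-1 : ℝ) 1, ‖z - x‖ < r := by
  simp [mem_thickening_iff, realSeg, dist_eq_norm]

lemma ofReal_mem_thickening {r x : ℝ} (hr : 0 < r) (hx : x ∈ Icc (-1 : ℝ) 1) :
    (x : ℂ) ∈ thickening r realSeg :=
  self_subset_thickening hr _ (mem_image_of_mem _ hx)

lemma convex_realSeg : Convex ℝ realSeg :=
  (convex_Icc (-1 : ℝ) 1).is_linear_image Complex.ofRealCLM.toLinearMap.isLinear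

lemma isOpen_nbhdBox {n : ℕ} (ρ : Fin n → ℝ) : IsOpen (nbhdBox ρ) := by
  simp only [nbhdBox, ofPred_forall]
  exact isOpen_iInter_of_finite fun i => isOpen_thickening.preimage (continuous_apply i)

lemma exists_near_of_mem_prefixBox {d : ℕ → ℝ} {n : ℕ} {z : Fin n → ℂ} (hz : z ∈ prefixBox d n) :
    ∃ x ∈ realCube n, ∀ i, ‖z i - x i‖ < d i := by
  choose x hx hzx using fun i => mem_thickening_realSeg.1 (hz i)
  exact ⟨x, hx, hzx⟩

lemma mem_prefixBox_of_near {d : ℕ → ℝ} {n : ℕ} {z : Fin n → ℂ} {x : Fin n → ℝ}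
    (hx : x ∈ realCube n) (hzx : ∀ i, ‖z i - x i‖ < d i) : z ∈ prefixBox d n :=
  fun i => mem_thickening_realSeg.2 ⟨x i, hx i, hzx i⟩

lemma toC_mem_prefixBox {d : ℕ → ℝ} (hd : ∀ i, 0 < d i) {n : ℕ} {x : Fin n → ℝ}
    (hx : x ∈ realCube n) : toC x ∈ prefixBox d n :=
  mem_prefixBox_of_near hx fun i => by simpa [toC] using hd i

lemma snoc_mem_prefixBox {d : ℕ → ℝ} {n : ℕ} {z : Fin n → ℂ} {s : ℂ} (hz : z ∈ prefixBox d n)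
    (hs : s ∈ thickening (d n) realSeg) :
    Fin.snoc (α := fun _ => ℂ) z s ∈ prefixBox d (n + 1) :=
  Fin.lastCases (by simpa using hs) fun i => by simpa using hz i

lemma snoc_mem_realCube {n : ℕ} {x : Fin n → ℝ} {s : ℝ} (hx : x ∈ realCube n)
    (hs : s ∈ Icc (-1 : ℝ) 1) : Fin.snoc (α := fun _ => ℝ) x s ∈ realCube (n + 1) :=
  Fin.lastCases (by simpa using hs) fun i => by simpa using hx i

lemma toC_snoc {n : ℕ} (x : Fin n → ℝ) (s : ℝ) :
    toC (Fin.snoc (α := fun _ => ℝ) x s) = Fin.snoc (α := fun _ => ℂ) (toC x) (s : ℂ) := by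
  funext i
  refine Fin.lastCases ?_ (fun i => ?_) i <;> simp [toC]

lemma toC_concat {n : ℕ} (x : Fin n → ℝ) (t : ℕ → ℝ) :
    toC (concat x t) = concat (toC x) (toC t) := by
  funext i
  simp only [toC, concat]
  split_ifs <;> rfl

lemma concat_mem_cube {n : ℕ} {x : Fin n → ℝ} (hx : x ∈ realCube n) {t : ℕ → ℝ} (ht : t ∈ cube) :
    concat x t ∈ cube := by
  intro i
  simp only [concat]
  split_ifs
  exacts [hx _, ht _]

lemma concat_snoc {α : Type*} {n : ℕ} (z : Fin n → α) (s : α) (t : ℕ → α) :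
    concat (Fin.snoc (α := fun _ => α) z s) t = concat z (concat (fun _ : Fin 1 => s) t) := by
  funext i
  simp only [concat, Fin.snoc, Fin.castLT, cast_eq]
  grind

lemma continuous_concat_toC {n : ℕ} :
    Continuous fun p : (Fin n → ℂ) × (ℕ → ℝ) => concat p.1 (toC p.2) := by
  refine continuous_pi fun i => ?_
  simp only [concat, toC]
  split_ifs <;> fun_prop

lemma differentiable_snoc {n : ℕ} :
    Differentiable ℂ fun p : (Fin n → ℂ) × ℂ =>
      (Fin.snoc (α := fun _ => ℂ) p.1 p.2 : Fin (n + 1) → ℂ) :=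
  differentiable_pi.2 <| Fin.lastCases (by simp) fun i => by
    simpa using differentiable_pi.1 differentiable_fst i

lemma measurableSet_cube : MeasurableSet cube := by
  simp only [cube, ofPred_forall]
  exact .iInter fun i => measurable_pi_apply i measurableSet_Icc

instance : IsProbabilityMeasure unifCube := by unfold unifCube; infer_instance

lemma ae_unif_mem_Icc : ∀ᵐ s ∂unif, s ∈ Icc (-1 : ℝ) 1 :=
  Measure.ae_smul_measure (ae_restrict_mem measurableSet_Icc) _

lemma ae_unifCube_mem_cube : ∀ᵐ t ∂unifCube, t ∈ cube :=
  ae_all_iff.2 fun i => (measurePreserving_eval_infinitePi (fun _ : ℕ => unif) i)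
    |>.quasiMeasurePreserving.ae ae_unif_mem_Icc

lemma integral_unif {E : Type*} [NormedAddCommGroup E] [NormedSpace ℝ E] (h : ℝ → E) :
    ∫ s, h s ∂unif = (2 : ℝ)⁻¹ • ∫ s in (-1 : ℝ)..1, h s := by
  rw [unif, integral_smul_measure, intervalIntegral.integral_of_le (by norm_num),
    integral_Icc_eq_integral_Ioc]
  simp

lemma measurePreserving_concat_one {X : Type*} [MeasurableSpace X] (ν : Measure X)
    [IsProbabilityMeasure ν] :
    MeasurePreserving (fun p : X × (ℕ → X) => concat (fun _ : Fin 1 => p.1) p.2)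
      (ν.prod (Measure.infinitePi fun _ => ν)) (Measure.infinitePi fun _ => ν) := by
  classical
  have hmeas : Measurable fun p : X × (ℕ → X) => concat (fun _ : Fin 1 => p.1) p.2 := by
    refine measurable_pi_lambda _ fun i => ?_
    simp only [concat]
    split_ifs <;> fun_prop
  refine ⟨hmeas, Measure.eq_infinitePi _ fun s t ht => ?_⟩
  set t' : ℕ → Set X := fun i => if i ∈ s then t i else univ with ht'_def
  have ht' : ∀ i, MeasurableSet (t' i) := fun i => by
    simp only [ht'_def]
    split_ifs
    exacts [ht i, .univ]
  have ht'_pi : Set.pi s t = Set.pi univ t' := by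
    ext x
    simp only [Set.mem_pi, ht'_def]
    grind
  have hpreimage : (fun p : X × (ℕ → X) => concat (fun _ : Fin 1 => p.1) p.2) ⁻¹' Set.pi univ t' =
      t' 0 ×ˢ Set.pi univ fun i => t' (i + 1) := by
    ext ⟨a, y⟩
    simp only [mem_preimage, Set.mem_pi, mem_univ, true_imp_iff, mem_prod]
    exact ⟨fun h => ⟨h 0, fun i => h (i + 1)⟩, fun h i => Nat.casesOn i h.1 h.2⟩
  rw [← Measure.infinitePi_pi (fun _ => ν) fun i _ => ht i, ht'_pi,
    Measure.map_apply hmeas (.univ_pi ht'), hpreimage, Measure.prod_prod,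
    Measure.infinitePi_pi_univ _ ht', Measure.infinitePi_pi_univ _ fun i => ht' (i + 1)]
  have hprod : ∀ u : ℕ → Set X,
      Tendsto (fun N => ∏ i ∈ Finset.range N, ν (u i)) atTop (𝓝 (∏' i, ν (u i))) := fun u =>
    (ENNReal.multipliable_of_le_one fun i => prob_le_one).hasProd.tendsto_prod_nat
  refine tendsto_nhds_unique
    (ENNReal.Tendsto.const_mul (hprod fun i => t' (i + 1)) (.inr (measure_ne_top ν _))) ?_
  simpa only [Finset.prod_range_succ', mul_comm] using (tendsto_add_atTop_iff_nat 1).2 (hprod t')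

/-! ### Distribution functions of complex densities -/

lemma exists_mem_closedBall_eq_of_approximatesLinearOn {𝕜 : Type*} [NontriviallyNormedField 𝕜]
    [CompleteSpace 𝕜] {G : 𝕜 → 𝕜} {b : 𝕜} {s : Set 𝕜} {κ : NNReal} (hb : b ≠ 0)
    (hG : ApproximatesLinearOn G (b • ContinuousLinearMap.id 𝕜 𝕜) s κ) {c y : 𝕜} {ρ : ℝ}
    (hρ : 0 ≤ ρ) (hs : closedBall c ρ ⊆ s) (hy : ‖y - G c‖ ≤ (‖b‖ - κ) * ρ) :
    ∃ w ∈ closedBall c ρ, G w = y := by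
  let inverse : (b • ContinuousLinearMap.id 𝕜 𝕜).NonlinearRightInverse :=
    { toFun := fun v => b⁻¹ * v
      nnnorm := ‖b⁻¹‖₊
      bound' := fun v => norm_mul_le _ _
      right_inv' := fun v => by simp [hb] }
  refine hG.surjOn_closedBall_of_nonlinearRightInverse inverse hρ hs ?_
  rw [mem_closedBall_iff_norm]
  simpa [inverse] using hy

/-- The integral of `p / 2` along the segment from `-1` to `s`. For a density `p` on `[-1,1]`
that is defined near the segment, this extends its distribution function to complex `s`. -/
def complexCDF (p : ℂ → ℂ) (s : ℂ) : ℂ :=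
  (s + 1) * ∫ t in (0 : ℝ)..1, p (-1 + t * (s + 1)) / 2

lemma complexCDF_ofReal (p : ℂ → ℂ) (s : ℝ) :
    complexCDF p s = ∫ t in (-1 : ℝ)..s, p t / 2 := by
  have := intervalIntegral.smul_integral_comp_add_mul (fun t : ℝ => p t / 2) (s + 1) (-1)
    (a := 0) (b := 1)
  simpa [complexCDF, mul_comm (s + 1 : ℂ)] using this

lemma norm_complexCDF_sub_complexCDF_le {p q : ℂ → ℂ} {ε : ℝ}
    (hp : ContinuousOn (fun t : ℝ => p t) (Icc (-1) 1))
    (hq : ContinuousOn (fun t : ℝ => q t) (Icc (-1) 1))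
    (hpq : ∀ t : ℝ, t ∈ Icc (-1) 1 → ‖p t - q t‖ ≤ ε) {s : ℝ} (hs : s ∈ Icc (-1) 1) :
    ‖complexCDF p s - complexCDF q s‖ ≤ ε := by
  have hint : ∀ {h : ℂ → ℂ}, ContinuousOn (fun t : ℝ => h t) (Icc (-1) 1) →
      IntervalIntegrable (fun t : ℝ => h t / 2) volume (-1) s := fun hh =>
    ((hh.mono (Icc_subset_Icc_right hs.2)).div_const 2).intervalIntegrable_of_Icc hs.1
  rw [complexCDF_ofReal, complexCDF_ofReal, ← intervalIntegral.integral_sub (hint hp) (hint hq)]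
  have hε : 0 ≤ ε := (norm_nonneg _).trans (hpq s hs)
  have hbound : ∀ t ∈ uIoc (-1) s, ‖p t / 2 - q t / 2‖ ≤ ε / 2 := fun t ht => by
    rw [uIoc_of_le hs.1] at ht
    rw [← sub_div, norm_div, Complex.norm_ofNat]
    gcongr
    exact hpq t ⟨ht.1.le, ht.2.trans hs.2⟩
  refine (intervalIntegral.norm_integral_le_of_norm_le_const hbound).trans ?_
  rw [abs_of_nonneg (by linarith [hs.1])]
  nlinarith [hs.2]

lemma differentiableOn_complexCDF {E : Type*} [NormedAddCommGroup E] [NormedSpace ℂ E]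
    [FiniteDimensional ℂ E] {P : E → ℂ → ℂ} {D : Set E} {S : Set ℂ} {B : ℝ} (hD : IsOpen D)
    (hS : IsOpen S) (hconv : Convex ℝ S) (hbase : -1 ∈ S)
    (hP : DifferentiableOn ℂ (fun w : E × ℂ => P w.1 w.2) (D ×ˢ S))
    (hB : ∀ z ∈ D, ∀ s ∈ S, ‖P z s‖ ≤ B) :
    DifferentiableOn ℂ (fun w : E × ℂ => complexCDF (P w.1) w.2) (D ×ˢ S) := by
  have hmem : ∀ w ∈ D ×ˢ S, ∀ t ∈ Ioc (0 : ℝ) 1, (w.1, -1 + t * (w.2 + 1)) ∈ D ×ˢ S :=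
    fun w hw t ht => ⟨hw.1, by
      simpa [mul_add] using hconv.add_smul_sub_mem hbase hw.2 (Ioc_subset_Icc_self ht)⟩
  have hIoc : ∀ᵐ t ∂volume.restrict (Ioc (0 : ℝ) 1), t ∈ Ioc (0 : ℝ) 1 :=
    ae_restrict_mem measurableSet_Ioc
  simp only [complexCDF, intervalIntegral.integral_of_le zero_le_one]
  refine DifferentiableOn.mul (by fun_prop) ?_
  refine differentiableOn_integral_of_bounded (B := B / 2) (hD.prod hS) (fun w hw => ?_) ?_ ?_
  · refine (ContinuousOn.div_const ?_ 2).aestronglyMeasurable measurableSet_Ioc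
    exact hP.continuousOn.comp (f := fun t : ℝ => (w.1, -1 + t * (w.2 + 1))) (by fun_prop)
      (hmem w hw)
  · filter_upwards [hIoc] with t ht
    have hcomp : DifferentiableOn ℂ (fun w : E × ℂ => P w.1 (-1 + t * (w.2 + 1))) (D ×ˢ S) :=
      hP.comp (f := fun w : E × ℂ => (w.1, -1 + t * (w.2 + 1))) (by fun_prop)
        fun w hw => hmem w hw t ht
    simpa only [div_eq_mul_inv] using hcomp.mul_const (2 : ℂ)⁻¹
  · filter_upwards [hIoc] with t ht w hw
    rw [norm_div, Complex.norm_ofNat]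
    gcongr
    exact hB _ (hmem w hw t ht).1 _ (hmem w hw t ht).2

/-- `p` is holomorphic on the open `r`-neighbourhood of `[-1,1]`, integrates to `1` over `[-1,1]`,
and each of its values there lies within `m / 4` of the real interval `[m, Λ]`. This is what is
used of a conditional density, considered as a function of its last variable. -/
structure HolomorphicDensity (m Λ r : ℝ) (p : ℂ → ℂ) : Prop where
  lower_pos : 0 < m
  radius_pos : 0 < r
  differentiableOn : DifferentiableOn ℂ p (thickening r realSeg)
  near : ∀ s ∈ thickening r realSeg, ∃ a ∈ Icc m Λ, ‖p s - a‖ ≤ m / 4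
  integral_eq_one : ∫ t : ℝ, p t ∂unif = 1

namespace HolomorphicDensity

variable {m Λ r : ℝ} {p : ℂ → ℂ} {s u v : ℂ}

lemma le_re (hp : HolomorphicDensity m Λ r p) (hs : s ∈ thickening r realSeg) :
    3 / 4 * m ≤ (p s).re := by
  obtain ⟨a, ha, hpa⟩ := hp.near s hs
  have hre := (abs_le.1 ((Complex.abs_re_le_norm _).trans hpa)).1
  rw [Complex.sub_re, Complex.ofReal_re] at hre
  linarith [ha.1]

lemma abs_im_le (hp : HolomorphicDensity m Λ r p) (hs : s ∈ thickening r realSeg) :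
    |(p s).im| ≤ m / 4 := by
  obtain ⟨a, -, hpa⟩ := hp.near s hs
  simpa using (Complex.abs_im_le_norm _).trans hpa

lemma half_le_norm (hp : HolomorphicDensity m Λ r p) (hs : s ∈ thickening r realSeg) :
    m / 2 ≤ ‖p s‖ := by
  linarith [hp.le_re hs, Complex.re_le_norm (p s), hp.lower_pos]

lemma norm_le (hp : HolomorphicDensity m Λ r p) (hs : s ∈ thickening r realSeg) :
    ‖p s‖ ≤ 2 * Λ := by
  obtain ⟨a, ha, hpa⟩ := hp.near s hs
  have := norm_le_norm_add_norm_sub' (p s) a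
  rw [Complex.norm_of_nonneg (hp.lower_pos.le.trans ha.1)] at this
  linarith [hp.lower_pos, ha.1, ha.2]

lemma lower_le_upper (hp : HolomorphicDensity m Λ r p) : m ≤ Λ := by
  obtain ⟨a, ha, -⟩ := hp.near _ (ofReal_mem_thickening hp.radius_pos (x := 1) (by norm_num))
  exact ha.1.trans ha.2

lemma continuousOn_ofReal (hp : HolomorphicDensity m Λ r p) :
    ContinuousOn (fun t : ℝ => p t) (Icc (-1) 1) :=
  hp.differentiableOn.continuousOn.comp Complex.continuous_ofReal.continuousOn fun _ ht =>
    ofReal_mem_thickening hp.radius_pos ht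

lemma hasDerivAt_complexCDF (hp : HolomorphicDensity m Λ r p) (hs : s ∈ thickening r realSeg) :
    HasDerivAt (complexCDF p) (p s / 2) s := by
  have hbase : ((-1 : ℝ) : ℂ) ∈ thickening r realSeg :=
    ofReal_mem_thickening hp.radius_pos (by norm_num)
  change HasDerivAt (fun w => complexCDF p w) _ _
  simpa [complexCDF] using hasDerivAt_mul_integral_segment (convex_realSeg.thickening r)
    isOpen_thickening (hp.differentiableOn.div_const 2) hbase hs

lemma approximatesLinearOn_complexCDF (hp : HolomorphicDensity m Λ r p) :
    ApproximatesLinearOn (complexCDF p) (((Λ / 2 : ℝ) : ℂ) • ContinuousLinearMap.id ℂ ℂ)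
      (thickening r realSeg) (Λ / 2 - 3 / 8 * m).toNNReal := by
  intro u hu v hv
  refine (convex_realSeg.thickening r).norm_image_sub_le_of_norm_hasFDerivWithin_le'
    (fun s hs => (hp.hasDerivAt_complexCDF hs).hasFDerivAt.hasFDerivWithinAt) (fun s hs => ?_) hv hu
  have hslope : ContinuousLinearMap.toSpanSingleton ℂ (p s / 2) -
      ((Λ / 2 : ℝ) : ℂ) • ContinuousLinearMap.id ℂ ℂ =
      ContinuousLinearMap.toSpanSingleton ℂ ((p s - Λ) / 2) := by
    ext
    simp [sub_div]
  obtain ⟨a, ha, hpa⟩ := hp.near s hs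
  have haΛ : ‖(a : ℂ) - Λ‖ = Λ - a := by
    rw [← Complex.ofReal_sub, Complex.norm_real, Real.norm_eq_abs, abs_sub_comm,
      abs_of_nonneg (by linarith [ha.2])]
  rw [hslope, ContinuousLinearMap.norm_toSpanSingleton, norm_div, Complex.norm_ofNat]
  refine le_trans ?_ (Real.le_coe_toNNReal _)
  linarith [norm_sub_le_norm_sub_add_norm_sub (p s) a Λ, ha.1]

lemma norm_complexCDF_sub_sub_le (hp : HolomorphicDensity m Λ r p)
    (hu : u ∈ thickening r realSeg) (hv : v ∈ thickening r realSeg) :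
    ‖complexCDF p u - complexCDF p v - (Λ / 2 : ℝ) * (u - v)‖ ≤
      (Λ / 2 - 3 / 8 * m) * ‖u - v‖ := by
  have hκ : 0 ≤ Λ / 2 - 3 / 8 * m := by linarith [hp.lower_le_upper, hp.lower_pos]
  simpa [Real.coe_toNNReal _ hκ] using hp.approximatesLinearOn_complexCDF u hu v hv

lemma mul_norm_sub_le_norm_complexCDF_sub (hp : HolomorphicDensity m Λ r p)
    (hu : u ∈ thickening r realSeg) (hv : v ∈ thickening r realSeg) :
    3 / 8 * m * ‖u - v‖ ≤ ‖complexCDF p u - complexCDF p v‖ := by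
  have hlinear : ‖((Λ / 2 : ℝ) : ℂ) * (u - v)‖ = Λ / 2 * ‖u - v‖ := by
    rw [norm_mul, Complex.norm_of_nonneg (by linarith [hp.lower_le_upper, hp.lower_pos])]
  have := norm_le_norm_add_norm_sub (complexCDF p u - complexCDF p v) ((Λ / 2 : ℝ) * (u - v))
  linarith [hp.norm_complexCDF_sub_sub_le hu hv]

lemma norm_complexCDF_sub_le (hp : HolomorphicDensity m Λ r p)
    (hu : u ∈ thickening r realSeg) (hv : v ∈ thickening r realSeg) :
    ‖complexCDF p u - complexCDF p v‖ ≤ Λ * ‖u - v‖ := by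
  have hlinear : ‖((Λ / 2 : ℝ) : ℂ) * (u - v)‖ = Λ / 2 * ‖u - v‖ := by
    rw [norm_mul, Complex.norm_of_nonneg (by linarith [hp.lower_le_upper, hp.lower_pos])]
  have := norm_le_norm_add_norm_sub' (complexCDF p u - complexCDF p v) ((Λ / 2 : ℝ) * (u - v))
  nlinarith [hp.norm_complexCDF_sub_sub_le hu hv, norm_nonneg (u - v), hp.lower_pos]

lemma injOn_complexCDF (hp : HolomorphicDensity m Λ r p) :
    InjOn (complexCDF p) (thickening r realSeg) := by
  intro u hu v hv huv
  have := hp.mul_norm_sub_le_norm_complexCDF_sub hu hv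
  rw [huv, sub_self, norm_zero] at this
  exact sub_eq_zero.1 (norm_le_zero_iff.1 (nonpos_of_mul_nonpos_right this
    (by linarith [hp.lower_pos])))

lemma exists_mem_complexCDF_eq (hp : HolomorphicDensity m Λ r p) {τ ρ : ℝ} (hτ : τ ∈ Icc (-1) 1)
    (hρ : 0 ≤ ρ) (hρr : ρ < r) (hu : ‖u - complexCDF p τ‖ ≤ 3 / 8 * m * ρ) :
    ∃ w ∈ thickening r realSeg, complexCDF p w = u := by
  have hΛ : 0 < Λ := hp.lower_pos.trans_le hp.lower_le_upper
  have hball : closedBall (τ : ℂ) ρ ⊆ thickening r realSeg := fun w hw =>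
    mem_thickening_realSeg.2 ⟨τ, hτ, (mem_closedBall_iff_norm.1 hw).trans_lt hρr⟩
  have hradius : 3 / 8 * m * ρ =
      (‖((Λ / 2 : ℝ) : ℂ)‖ - (Λ / 2 - 3 / 8 * m).toNNReal) * ρ := by
    rw [Complex.norm_of_nonneg (half_pos hΛ).le,
      Real.coe_toNNReal _ (by linarith [hp.lower_le_upper, hp.lower_pos])]
    ring
  obtain ⟨w, hw, hwu⟩ := exists_mem_closedBall_eq_of_approximatesLinearOn
    (by exact_mod_cast (half_pos hΛ).ne') hp.approximatesLinearOn_complexCDF hρ hball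
    (hu.trans_eq hradius)
  exact ⟨w, hball hw, hwu⟩

lemma norm_sub_one_le (hp : HolomorphicDensity m Λ r p) {x : ℝ} (hx : x ∈ Icc (-1) 1)
    (hsr : ‖s - x‖ < r / 2) (hs1 : ‖s - x‖ ≤ 1) : ‖p s - 1‖ ≤ 24 * Λ / r := by
  have hΛ : 0 < Λ := hp.lower_pos.trans_le hp.lower_le_upper
  have hr := hp.radius_pos
  have hint : Integrable (fun t : ℝ => p t) unif :=
    (hp.continuousOn_ofReal.integrableOn_compact isCompact_Icc).smul_measure (by simp)
  have hmean : p s - 1 = ∫ t : ℝ, (p s - p t) ∂unif := by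
    rw [integral_sub (integrable_const _) hint, hp.integral_eq_one]
    simp
  have hbound : ∀ᵐ t ∂unif, ‖p s - p (t : ℝ)‖ ≤ 24 * Λ / r := by
    filter_upwards [ae_unif_mem_Icc] with t ht
    have hst : ‖s - t‖ ≤ 3 := by
      have hxt : ‖(x : ℂ) - t‖ ≤ 2 := by
        rw [← Complex.ofReal_sub, Complex.norm_real, Real.norm_eq_abs, abs_le]
        constructor <;> linarith [hx.1, hx.2, ht.1, ht.2]
      linarith [norm_sub_le_norm_sub_add_norm_sub s x t]
    calc ‖p s - p t‖ ≤ 4 * (2 * Λ) / r * ‖s - t‖ :=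
          norm_sub_le_of_differentiableOn_thickening convex_realSeg hp.differentiableOn
            (fun z hz => hp.norm_le hz) (mem_thickening_realSeg.2 ⟨x, hx, hsr⟩)
            (ofReal_mem_thickening (half_pos hr) ht)
      _ ≤ 4 * (2 * Λ) / r * 3 := by gcongr
      _ = 24 * Λ / r := by ring
  rw [hmean]
  simpa using norm_integral_le_of_norm_le_const hbound

end HolomorphicDensity

/-! ### Marginals of admissible densities -/

/-- The marginal `f̂_n` for complex arguments. -/
def complexMarginal (f : (ℕ → ℂ) → ℂ) (n : ℕ) (z : Fin n → ℂ) : ℂ :=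
  ∫ t, f (concat z (toC t)) ∂unifCube

/-- The conditional density of the variable number `n`, for complex arguments. -/
def complexCondDensity (f : (ℕ → ℂ) → ℂ) (n : ℕ) (z : Fin n → ℂ) (s : ℂ) : ℂ :=
  complexMarginal f (n + 1) (Fin.snoc (α := fun _ => ℂ) z s) / complexMarginal f n z

lemma concat_eq_toC_concat_add {n : ℕ} (z : Fin n → ℂ) (x : Fin n → ℝ) (t : ℕ → ℝ) :
    concat z (toC t) = toC (concat x t) + concat (z - toC x) 0 := by
  funext i
  simp only [concat, toC, Pi.add_apply, Pi.sub_apply, Pi.zero_apply]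
  split_ifs <;> simp

lemma concat_snoc_sub_toC_snoc {n : ℕ} (z : Fin n → ℂ) (x : Fin n → ℝ) (s : ℝ) :
    concat (Fin.snoc (α := fun _ => ℂ) z s - toC (Fin.snoc (α := fun _ => ℝ) x s)) 0 =
      concat (z - toC x) 0 := by
  funext i
  simp only [concat, toC_snoc, Fin.snoc, Fin.castLT, cast_eq, Pi.sub_apply, Pi.zero_apply]
  grind

lemma concat_sub_mem_discBoxTimesZero {d : ℕ → ℝ} {k n : ℕ} {z : Fin n → ℂ}
    {x : Fin n → ℝ} (hzx : ∀ i, ‖z i - x i‖ < d i) :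
    concat (z - toC x) 0 ∈ discBoxTimesZero (fun i : Fin k => d i) n := by
  refine ⟨fun i hi => ?_, fun i hi => ?_⟩
  · simpa [concat, hi, toC] using hzx ⟨i, hi⟩
  · simp [concat, hi.not_gt]

lemma norm_div_sub_div_le {M L D : ℝ} (hM : 0 < M) (hML : M ≤ L) {A A₀ B B₀ : ℂ}
    (hA : ‖A - A₀‖ ≤ D) (hB : ‖B - B₀‖ ≤ D) (hA₀ : ‖A₀‖ ≤ L) (hB₀ : M ≤ ‖B₀‖)
    (hB' : M / 2 ≤ ‖B‖) : ‖A / B - A₀ / B₀‖ ≤ 4 * L / M ^ 2 * D := by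
  have hD : 0 ≤ D := (norm_nonneg _).trans hA
  have hb : B ≠ 0 := norm_pos_iff.1 ((half_pos hM).trans_le hB')
  have hb₀ : B₀ ≠ 0 := norm_pos_iff.1 (hM.trans_le hB₀)
  have hnum : ‖A - A₀‖ / ‖B‖ ≤ L * D / (M / 2 * M) := by
    calc ‖A - A₀‖ / ‖B‖ ≤ D / (M / 2) := by gcongr
      _ = M * D / (M / 2 * M) := by field_simp
      _ ≤ L * D / (M / 2 * M) := by gcongr
  have hden : ‖A₀‖ * ‖B - B₀‖ / (‖B‖ * ‖B₀‖) ≤ L * D / (M / 2 * M) := by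
    have := hM.trans_le hML
    gcongr
  calc ‖A / B - A₀ / B₀‖ = ‖(A - A₀) / B - A₀ * (B - B₀) / (B * B₀)‖ := by
        congr 1
        field_simp
        ring
    _ ≤ ‖A - A₀‖ / ‖B‖ + ‖A₀‖ * ‖B - B₀‖ / (‖B‖ * ‖B₀‖) := by
        simpa only [norm_div, norm_mul] using
          norm_sub_le ((A - A₀) / B) (A₀ * (B - B₀) / (B * B₀))
    _ ≤ L * D / (M / 2 * M) + L * D / (M / 2 * M) := add_le_add hnum hden
    _ = 4 * L / M ^ 2 * D := by field_simp; ring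

namespace Admissible

variable {M L C : ℝ} {k n : ℕ} {d : ℕ → ℝ} {f : (ℕ → ℂ) → ℂ}

lemma concat_mem_nbhdBoxTimesCube (hd : ∀ i, 0 < d i) (hn : n ≤ k) {z : Fin n → ℂ}
    (hz : z ∈ prefixBox d n) {t : ℕ → ℝ} (ht : t ∈ cube) :
    concat z (toC t) ∈ nbhdBoxTimesCube fun i : Fin k => d i := by
  refine ⟨fun i => ?_, fun i hi => ?_⟩
  · simp only [concat]
    split_ifs with h
    · exact hz ⟨i, h⟩
    · exact ofReal_mem_thickening (hd i) (ht _)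
  · simp only [concat, dif_neg (hn.trans hi).not_gt]
    exact ⟨_, ht _, rfl⟩

lemma aestronglyMeasurable_concat (hd : ∀ i, 0 < d i)
    (hf : Admissible M L C (fun i : Fin k => d i) f) (hn : n ≤ k) {z : Fin n → ℂ}
    (hz : z ∈ prefixBox d n) : AEStronglyMeasurable (fun t => f (concat z (toC t))) unifCube := by
  have hcont : ContinuousOn (fun t : ℕ → ℝ => f (concat z (toC t))) cube :=
    hf.continuousOn.comp (continuous_concat_toC.comp (Continuous.prodMk_right z)).continuousOn
      fun t ht => concat_mem_nbhdBoxTimesCube hd hn hz ht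
  simpa only [Measure.restrict_eq_self_of_ae_mem ae_unifCube_mem_cube] using
    hcont.aestronglyMeasurable (μ := unifCube) measurableSet_cube

lemma ae_norm_concat_le (hd : ∀ i, 0 < d i) (hf : Admissible M L C (fun i : Fin k => d i) f)
    (hn : n ≤ k) : ∀ᵐ t ∂unifCube, ∀ z ∈ prefixBox d n, ‖f (concat z (toC t))‖ ≤ L :=
  ae_unifCube_mem_cube.mono fun _ ht _ hz => hf.upper _ (concat_mem_nbhdBoxTimesCube hd hn hz ht)

lemma integrable_concat (hd : ∀ i, 0 < d i) (hf : Admissible M L C (fun i : Fin k => d i) f)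
    (hn : n ≤ k) {z : Fin n → ℂ} (hz : z ∈ prefixBox d n) :
    Integrable (fun t => f (concat z (toC t))) unifCube :=
  .of_bound (hf.aestronglyMeasurable_concat hd hn hz) L
    ((hf.ae_norm_concat_le hd hn).mono fun _ ht => ht z hz)

lemma differentiableOn_concat (hd : ∀ i, 0 < d i)
    (hf : Admissible M L C (fun i : Fin k => d i) f) (hn : n ≤ k) {t : ℕ → ℝ} (ht : t ∈ cube) :
    DifferentiableOn ℂ (fun z : Fin n → ℂ => f (concat z (toC t))) (prefixBox d n) := by
  let complete : (Fin n → ℂ) → Fin k → ℂ := fun z i => concat z (toC t) i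
  have hdiff : Differentiable ℂ complete := by
    refine differentiable_pi.2 fun i => ?_
    simp only [complete, concat]
    split_ifs <;> fun_prop
  have hmaps : MapsTo complete (prefixBox d n) (nbhdBox fun i : Fin k => d i) := fun z hz =>
    (concat_mem_nbhdBoxTimesCube hd hn hz ht).1
  have hcomplete : ∀ z, concat (complete z) (toC fun i => t (i + (k - n))) = concat z (toC t) := by
    intro z
    funext i
    simp only [concat, toC, complete]
    grind
  simpa only [Function.comp_def, hcomplete] using
    (hf.holomorphic _ fun i => ht (i + (k - n))).comp hdiff.differentiableOn hmaps

lemma differentiableOn_complexMarginal (hd : ∀ i, 0 < d i)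
    (hf : Admissible M L C (fun i : Fin k => d i) f) (hn : n ≤ k) :
    DifferentiableOn ℂ (complexMarginal f n) (prefixBox d n) :=
  differentiableOn_integral_of_bounded (isOpen_nbhdBox _)
    (fun _ hz => hf.aestronglyMeasurable_concat hd hn hz)
    (ae_unifCube_mem_cube.mono fun _ ht => hf.differentiableOn_concat hd hn ht)
    (hf.ae_norm_concat_le hd hn)

lemma norm_complexMarginal_sub_le (hd : ∀ i, 0 < d i)
    (hf : Admissible M L C (fun i : Fin k => d i) f) (hn : n ≤ k) {D : ℝ} {z : Fin n → ℂ}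
    {x : Fin n → ℝ} (hz : z ∈ prefixBox d n) (hx : x ∈ realCube n)
    (hD : ∀ u ∈ cube, ‖f (toC u + concat (z - toC x) 0) - f (toC u)‖ ≤ D) :
    ‖complexMarginal f n z - complexMarginal f n (toC x)‖ ≤ D := by
  rw [complexMarginal, complexMarginal, ← integral_sub (hf.integrable_concat hd hn hz)
    (hf.integrable_concat hd hn (toC_mem_prefixBox hd hx))]
  refine (norm_integral_le_of_norm_le_const (C := D) ?_).trans_eq (by simp)
  filter_upwards [ae_unifCube_mem_cube] with t ht
  rw [concat_eq_toC_concat_add z x, ← toC_concat]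
  exact hD _ (concat_mem_cube hx ht)

lemma norm_apply_sub_le (hd : ∀ i, 0 < d i) (hf : Admissible M L C (fun i : Fin k => d i) f)
    (hn : n ≤ k) {x : ℕ → ℝ} (hx : x ∈ cube) {y : ℕ → ℂ}
    (hy : y ∈ discBoxTimesZero (fun i : Fin k => d i) n) :
    ‖f (toC x + y) - f (toC x)‖ ≤ C := by
  refine hf.small x hx y ⟨fun i _ => ?_, fun i hi => hy.2 i (hn.trans hi)⟩
  rcases lt_or_ge (i : ℕ) n with h | h
  · exact hy.1 i h
  · simpa [hy.2 i h] using hd i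

lemma const_nonneg (hd : ∀ i, 0 < d i) (hf : Admissible M L C (fun i : Fin k => d i) f) :
    0 ≤ C :=
  (norm_nonneg _).trans <| hf.norm_apply_sub_le hd k.zero_le (x := 0) (y := 0)
    (fun _ => by simp) ⟨fun i _ => by simpa using hd i, fun _ _ => rfl⟩

lemma norm_apply_sub_le_min (hd : ∀ i, 0 < d i) (hf : Admissible M L C (fun i : Fin k => d i) f)
    (hn : n < k) {x : ℕ → ℝ} (hx : x ∈ cube) {y : ℕ → ℂ}
    (hy : y ∈ discBoxTimesZero (fun i : Fin k => d i) n) :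
    ‖f (toC x + y) - f (toC x)‖ ≤ C * min 1 (d n) := by
  have hC := hf.const_nonneg hd
  rw [mul_min_of_nonneg _ _ hC, mul_one]
  refine le_min (hf.norm_apply_sub_le hd hn.le hx hy) ?_
  rcases n.eq_zero_or_pos with rfl | hpos
  · obtain rfl : y = 0 := funext fun i => hy.2 i i.zero_le
    simpa using mul_nonneg hC (hd 0).le
  · exact hf.small_next n hpos hn x hx y hy

lemma apply_toC (hf : Admissible M L C (fun i : Fin k => d i) f) {x : ℕ → ℝ} (hx : x ∈ cube) :
    f (toC x) = realRestr f x :=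
  Complex.ext (by simp [realRestr]) (by simp [hf.density.real x hx])

lemma realRestr_mem_Icc (hd : ∀ i, 0 < d i) (hf : Admissible M L C (fun i : Fin k => d i) f)
    {x : ℕ → ℝ} (hx : x ∈ cube) : realRestr f x ∈ Icc M L := by
  have hmem : toC x ∈ nbhdBoxTimesCube fun i : Fin k => d i :=
    ⟨fun i => ofReal_mem_thickening (hd i) (hx i), fun i _ => ⟨_, hx i, rfl⟩⟩
  have hnorm : ‖f (toC x)‖ = realRestr f x := by
    rw [hf.apply_toC hx]
    exact Complex.norm_of_nonneg (hf.density.pos x hx).le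
  exact ⟨hnorm ▸ hf.lower _ hmem, hnorm ▸ hf.upper _ hmem⟩

lemma lower_le_upper (hd : ∀ i, 0 < d i) (hf : Admissible M L C (fun i : Fin k => d i) f) :
    M ≤ L :=
  have h := hf.realRestr_mem_Icc hd (x := 0) fun _ => by simp
  h.1.trans h.2

lemma complexMarginal_toC (hf : Admissible M L C (fun i : Fin k => d i) f) {x : Fin n → ℝ}
    (hx : x ∈ realCube n) : complexMarginal f n (toC x) = marginal (realRestr f) n x := by
  rw [complexMarginal, marginal, ← integral_complex_ofReal]
  refine integral_congr_ae ?_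
  filter_upwards [ae_unifCube_mem_cube] with t ht
  rw [← toC_concat, hf.apply_toC (concat_mem_cube hx ht)]

lemma marginal_mem_Icc (hd : ∀ i, 0 < d i) (hf : Admissible M L C (fun i : Fin k => d i) f)
    (hn : n ≤ k) {x : Fin n → ℝ} (hx : x ∈ realCube n) :
    marginal (realRestr f) n x ∈ Icc M L := by
  have hint : Integrable (fun t => realRestr f (concat x t)) unifCube := by
    simpa only [realRestr, toC_concat, RCLike.re_eq_complex_re] using
      (hf.integrable_concat hd hn (toC_mem_prefixBox hd hx)).re
  have hmem : ∀ᵐ t ∂unifCube, realRestr f (concat x t) ∈ Icc M L :=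
    ae_unifCube_mem_cube.mono fun _ ht => hf.realRestr_mem_Icc hd (concat_mem_cube hx ht)
  exact (convex_Icc M L).integral_mem isClosed_Icc hmem hint

lemma complexMarginal_eq_integral (hd : ∀ i, 0 < d i)
    (hf : Admissible M L C (fun i : Fin k => d i) f) (hn : n ≤ k) {z : Fin n → ℂ}
    (hz : z ∈ prefixBox d n) :
    complexMarginal f n z =
      ∫ s : ℝ, complexMarginal f (n + 1) (Fin.snoc (α := fun _ => ℂ) z (s : ℂ)) ∂unif := by
  have hmp : MeasurePreserving (fun p : ℝ × (ℕ → ℝ) => concat (fun _ : Fin 1 => p.1) p.2)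
      (unif.prod unifCube) unifCube := measurePreserving_concat_one unif
  have hint := hf.integrable_concat hd hn hz
  have htoC : ∀ p : ℝ × (ℕ → ℝ), toC (concat (fun _ : Fin 1 => p.1) p.2) =
      concat (fun _ : Fin 1 => (p.1 : ℂ)) (toC p.2) := fun p => toC_concat _ _
  have hprod : Integrable (fun p : ℝ × (ℕ → ℝ) =>
      f (concat (Fin.snoc (α := fun _ => ℂ) z (p.1 : ℂ)) (toC p.2))) (unif.prod unifCube) := by
    simpa only [concat_snoc, Function.comp_def, htoC] using
      (hmp.integrable_comp hint.aestronglyMeasurable).2 hint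
  calc complexMarginal f n z
      = ∫ p : ℝ × (ℕ → ℝ), f (concat (Fin.snoc (α := fun _ => ℂ) z (p.1 : ℂ)) (toC p.2))
          ∂unif.prod unifCube := by
        simp only [concat_snoc, ← htoC]
        rw [complexMarginal, ← integral_map (f := fun t => f (concat z (toC t))) hmp.aemeasurable
          (by rw [hmp.map_eq]; exact hint.aestronglyMeasurable), hmp.map_eq]
    _ = _ := integral_prod _ hprod

end Admissible

/-- `p` extends the conditional densities of `f` for the first `k` variables holomorphically to
the neighbourhoods of `[-1,1]ⁿ` with radii `d`, it takes values near `[m, Λ]`, and the density of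
each variable moves by at most `m / 64 * min 1 (d n)` when only the earlier variables leave the
reals. This is what the transport theory uses of a density. -/
structure HolomorphicDisintegration (m Λ : ℝ) (d : ℕ → ℝ) (k : ℕ) (f : (ℕ → ℝ) → ℝ)
    (p : ∀ n, (Fin n → ℂ) → ℂ → ℂ) : Prop where
  lower_pos : 0 < m
  lower_le_upper : m ≤ Λ
  radius_pos : ∀ i, 0 < d i
  density : ∀ n < k, ∀ z ∈ prefixBox d n, HolomorphicDensity m Λ (d n) (p n z)
  differentiableOn : ∀ n < k, DifferentiableOn ℂ (fun w : (Fin n → ℂ) × ℂ => p n w.1 w.2)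
    (prefixBox d n ×ˢ thickening (d n) realSeg)
  eq_ofReal : ∀ n < k, ∀ x ∈ realCube n, ∀ s ∈ Icc (-1 : ℝ) 1,
    p n (toC x) s = condDensity f n x s
  norm_sub_le : ∀ n < k, ∀ z : Fin n → ℂ, ∀ x ∈ realCube n, (∀ i, ‖z i - x i‖ < d i) →
    ∀ s : ℝ, s ∈ Icc (-1) 1 → ‖p n z s - p n (toC x) s‖ ≤ m / 64 * min 1 (d n)

lemma four_mul_div_sq_mul_le_of_le_cube_div_sq {M L C : ℝ} (hM : 0 < M) (hML : M ≤ L)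
    (hC : C ≤ M ^ 3 / (256 * L ^ 2)) :
    4 * L / M ^ 2 * C ≤ M / L / 64 := by
  have hL := hM.trans_le hML
  calc 4 * L / M ^ 2 * C ≤ 4 * L / M ^ 2 * (M ^ 3 / (256 * L ^ 2)) := by gcongr
    _ = M / L / 64 := by field_simp; norm_num

lemma le_half_of_le_cube_div_sq {M L C : ℝ} (hM : 0 < M) (hML : M ≤ L)
    (hC : C ≤ M ^ 3 / (256 * L ^ 2)) : C ≤ M / 2 := by
  have hL := hM.trans_le hML
  refine hC.trans ?_
  rw [div_le_div_iff₀ (by positivity) two_pos]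
  nlinarith [mul_le_mul_of_nonneg_left (pow_le_pow_left₀ hM.le hML 2) hM.le]

namespace Admissible

variable {M L C : ℝ} {k n : ℕ} {d : ℕ → ℝ} {f : (ℕ → ℂ) → ℂ}

lemma le_norm_complexMarginal_toC (hd : ∀ i, 0 < d i)
    (hf : Admissible M L C (fun i : Fin k => d i) f) (hn : n ≤ k) {x : Fin n → ℝ}
    (hx : x ∈ realCube n) : M ≤ ‖complexMarginal f n (toC x)‖ := by
  rw [hf.complexMarginal_toC hx, Complex.norm_real]
  exact (hf.marginal_mem_Icc hd hn hx).1.trans (Real.le_norm_self _)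

lemma norm_complexMarginal_toC_le (hM : 0 < M) (hd : ∀ i, 0 < d i)
    (hf : Admissible M L C (fun i : Fin k => d i) f) (hn : n ≤ k) {x : Fin n → ℝ}
    (hx : x ∈ realCube n) : ‖complexMarginal f n (toC x)‖ ≤ L := by
  have h := hf.marginal_mem_Icc hd hn hx
  rw [hf.complexMarginal_toC hx, Complex.norm_of_nonneg (hM.le.trans h.1)]
  exact h.2

lemma half_le_norm_complexMarginal (hC : C ≤ M / 2) (hd : ∀ i, 0 < d i)
    (hf : Admissible M L C (fun i : Fin k => d i) f) (hn : n ≤ k) {z : Fin n → ℂ}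
    (hz : z ∈ prefixBox d n) : M / 2 ≤ ‖complexMarginal f n z‖ := by
  obtain ⟨x, hx, hzx⟩ := exists_near_of_mem_prefixBox hz
  have hclose := hf.norm_complexMarginal_sub_le hd hn hz hx fun u hu =>
    hf.norm_apply_sub_le hd hn hu (concat_sub_mem_discBoxTimesZero hzx)
  have := norm_le_norm_add_norm_sub (complexMarginal f n z) (complexMarginal f n (toC x))
  linarith [hf.le_norm_complexMarginal_toC hd hn hx]

lemma norm_complexCondDensity_sub_le (hM : 0 < M) (hC : C ≤ M / 2) (hd : ∀ i, 0 < d i)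
    (hf : Admissible M L C (fun i : Fin k => d i) f) (hn : n < k) {D : ℝ} {z : Fin n → ℂ}
    {x : Fin n → ℝ} {s : ℂ} {σ : ℝ} (hx : x ∈ realCube n) (hσ : σ ∈ Icc (-1) 1)
    (hz : z ∈ prefixBox d n) (hs : s ∈ thickening (d n) realSeg)
    (hD : ∀ u ∈ cube, ‖f (toC u + concat (z - toC x) 0) - f (toC u)‖ ≤ D)
    (hD' : ∀ u ∈ cube, ‖f (toC u + concat (Fin.snoc (α := fun _ => ℂ) z s -
      toC (Fin.snoc (α := fun _ => ℝ) x σ)) 0) - f (toC u)‖ ≤ D) :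
    ‖complexCondDensity f n z s - complexCondDensity f n (toC x) σ‖ ≤ 4 * L / M ^ 2 * D := by
  rw [complexCondDensity, complexCondDensity, ← toC_snoc]
  exact norm_div_sub_div_le hM (hf.lower_le_upper hd)
    (hf.norm_complexMarginal_sub_le hd hn (snoc_mem_prefixBox hz hs) (snoc_mem_realCube hx hσ) hD')
    (hf.norm_complexMarginal_sub_le hd hn.le hz hx hD)
    (hf.norm_complexMarginal_toC_le hM hd hn (snoc_mem_realCube hx hσ))
    (hf.le_norm_complexMarginal_toC hd hn.le hx) (hf.half_le_norm_complexMarginal hC hd hn.le hz)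

lemma complexCondDensity_toC (hf : Admissible M L C (fun i : Fin k => d i) f)
    {x : Fin n → ℝ} (hx : x ∈ realCube n) {s : ℝ} (hs : s ∈ Icc (-1 : ℝ) 1) :
    complexCondDensity f n (toC x) s = condDensity (realRestr f) n x s := by
  rw [complexCondDensity, ← toC_snoc, hf.complexMarginal_toC hx,
    hf.complexMarginal_toC (snoc_mem_realCube hx hs), condDensity, Complex.ofReal_div]

lemma condDensity_mem_Icc (hM : 0 < M) (hd : ∀ i, 0 < d i)
    (hf : Admissible M L C (fun i : Fin k => d i) f) (hn : n < k) {x : Fin n → ℝ}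
    (hx : x ∈ realCube n) {s : ℝ} (hs : s ∈ Icc (-1 : ℝ) 1) :
    condDensity (realRestr f) n x s ∈ Icc (M / L) (L / M) := by
  have hnum := hf.marginal_mem_Icc hd hn (snoc_mem_realCube hx hs)
  have hden := hf.marginal_mem_Icc hd hn.le hx
  have hL := hM.trans_le (hf.lower_le_upper hd)
  have hpos := hM.trans_le hden.1
  exact ⟨div_le_div₀ (hM.le.trans hnum.1) hnum.1 hpos hden.2,
    div_le_div₀ hL.le hnum.2 hM hden.1⟩

lemma differentiableOn_complexCondDensity (hM : 0 < M) (hC : C ≤ M / 2) (hd : ∀ i, 0 < d i)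
    (hf : Admissible M L C (fun i : Fin k => d i) f) (hn : n < k) :
    DifferentiableOn ℂ (fun w : (Fin n → ℂ) × ℂ => complexCondDensity f n w.1 w.2)
      (prefixBox d n ×ˢ thickening (d n) realSeg) := by
  have hnum : DifferentiableOn ℂ
      (fun w : (Fin n → ℂ) × ℂ => complexMarginal f (n + 1) (Fin.snoc (α := fun _ => ℂ) w.1 w.2))
      (prefixBox d n ×ˢ thickening (d n) realSeg) :=
    (hf.differentiableOn_complexMarginal hd hn).comp differentiable_snoc.differentiableOn
      fun w hw => snoc_mem_prefixBox hw.1 hw.2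
  have hden : DifferentiableOn ℂ (fun w : (Fin n → ℂ) × ℂ => complexMarginal f n w.1)
      (prefixBox d n ×ˢ thickening (d n) realSeg) :=
    (hf.differentiableOn_complexMarginal hd hn.le).comp differentiableOn_fst fun w hw => hw.1
  have hne : ∀ w ∈ prefixBox d n ×ˢ thickening (d n) realSeg, complexMarginal f n w.1 ≠ 0 :=
    fun w hw => norm_pos_iff.1 <|
      (half_pos hM).trans_le (hf.half_le_norm_complexMarginal hC hd hn.le hw.1)
  simp only [complexCondDensity, div_eq_mul_inv]
  exact hnum.mul (hden.fun_inv hne)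

lemma integral_complexCondDensity (hM : 0 < M) (hC : C ≤ M / 2) (hd : ∀ i, 0 < d i)
    (hf : Admissible M L C (fun i : Fin k => d i) f) (hn : n < k) {z : Fin n → ℂ}
    (hz : z ∈ prefixBox d n) : ∫ s : ℝ, complexCondDensity f n z s ∂unif = 1 := by
  unfold complexCondDensity
  rw [integral_div, ← hf.complexMarginal_eq_integral hd hn.le hz]
  exact div_self <| norm_pos_iff.1 <|
    (half_pos hM).trans_le (hf.half_le_norm_complexMarginal hC hd hn.le hz)

lemma holomorphicDensity (hM : 0 < M) (hC : C ≤ M ^ 3 / (256 * L ^ 2)) (hd : ∀ i, 0 < d i)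
    (hf : Admissible M L C (fun i : Fin k => d i) f) (hn : n < k) {z : Fin n → ℂ}
    (hz : z ∈ prefixBox d n) :
    HolomorphicDensity (M / L) (L / M) (d n) (complexCondDensity f n z) := by
  have hML := hf.lower_le_upper hd
  have hhalf := le_half_of_le_cube_div_sq hM hML hC
  have hm : 0 < M / L := div_pos hM (hM.trans_le hML)
  refine ⟨hm, hd n, ?_, fun s hs => ?_, hf.integral_complexCondDensity hM hhalf hd hn hz⟩
  · exact (hf.differentiableOn_complexCondDensity hM hhalf hd hn).comp
      (f := fun s : ℂ => (z, s)) (by fun_prop) fun s hs => ⟨hz, hs⟩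
  · obtain ⟨x, hx, hzx⟩ := exists_near_of_mem_prefixBox hz
    obtain ⟨σ, hσ, hsσ⟩ := mem_thickening_realSeg.1 hs
    refine ⟨_, hf.condDensity_mem_Icc hM hd hn hx hσ, ?_⟩
    rw [← hf.complexCondDensity_toC hx hσ]
    have hclose := hf.norm_complexCondDensity_sub_le hM hhalf hd hn hx hσ hz hs
      (fun u hu => hf.norm_apply_sub_le hd hn.le hu (concat_sub_mem_discBoxTimesZero hzx))
      (fun u hu => hf.norm_apply_sub_le hd hn hu <| concat_sub_mem_discBoxTimesZero <|
        Fin.lastCases (by simpa using hsσ) fun i => by simpa using hzx i)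
    linarith [four_mul_div_sq_mul_le_of_le_cube_div_sq hM hML hC]

theorem holomorphicDisintegration (hM : 0 < M) (hC : C ≤ M ^ 3 / (256 * L ^ 2))
    (hd : ∀ i, 0 < d i) (hf : Admissible M L C (fun i : Fin k => d i) f) :
    HolomorphicDisintegration (M / L) (L / M) d k (realRestr f) (complexCondDensity f) where
  lower_pos := div_pos hM (hM.trans_le (hf.lower_le_upper hd))
  lower_le_upper := ((div_le_one (hM.trans_le (hf.lower_le_upper hd))).2
    (hf.lower_le_upper hd)).trans ((one_le_div hM).2 (hf.lower_le_upper hd))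
  radius_pos := hd
  density _ hn _ hz := hf.holomorphicDensity hM hC hd hn hz
  differentiableOn _ hn :=
    hf.differentiableOn_complexCondDensity hM
      (le_half_of_le_cube_div_sq hM (hf.lower_le_upper hd) hC) hd hn
  eq_ofReal _ _ _ hx _ hs := hf.complexCondDensity_toC hx hs
  norm_sub_le n hn z x hx hzx s hs := by
    have hclose := fun u hu =>
      hf.norm_apply_sub_le_min hd hn (x := u) hu (concat_sub_mem_discBoxTimesZero hzx)
    calc ‖complexCondDensity f n z s - complexCondDensity f n (toC x) s‖
        ≤ 4 * L / M ^ 2 * (C * min 1 (d n)) :=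
          hf.norm_complexCondDensity_sub_le hM
            (le_half_of_le_cube_div_sq hM (hf.lower_le_upper hd) hC) hd hn hx hs
            (mem_prefixBox_of_near hx hzx) (ofReal_mem_thickening (hd n) hs) hclose
            (by simpa only [concat_snoc_sub_toC_snoc] using hclose)
      _ = 4 * L / M ^ 2 * C * min 1 (d n) := by ring
      _ ≤ M / L / 64 * min 1 (d n) := by
          have := (hd n).le
          gcongr
          exact four_mul_div_sq_mul_le_of_le_cube_div_sq hM (hf.lower_le_upper hd) hC

end Admissible

/-! ### The real transport -/

lemma init_mem_realCube {n : ℕ} {x : Fin (n + 1) → ℝ} (hx : x ∈ realCube (n + 1)) :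
    Fin.init x ∈ realCube n :=
  fun i => hx i.castSucc

lemma condCDF_neg_one (f : (ℕ → ℝ) → ℝ) (n : ℕ) (x : Fin n → ℝ) : condCDF f n x (-1) = 0 :=
  intervalIntegral.integral_same

lemma transport_succ_last (f g : (ℕ → ℝ) → ℝ) (n : ℕ) (x : Fin (n + 1) → ℝ) :
    transport f g (n + 1) x (Fin.last n) =
      Function.invFunOn (condCDF g n (transport f g n (Fin.init x))) (Icc (-1) 1)
        (condCDF f n (Fin.init x) (x (Fin.last n))) := by
  simp [transport]

lemma init_transport_succ (f g : (ℕ → ℝ) → ℝ) (n : ℕ) (x : Fin (n + 1) → ℝ) :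
    Fin.init (transport f g (n + 1) x) = transport f g n (Fin.init x) := by
  simp [transport]

namespace HolomorphicDisintegration

variable {m Λ : ℝ} {d : ℕ → ℝ} {k n : ℕ} {f g : (ℕ → ℝ) → ℝ} {p q : ∀ n, (Fin n → ℂ) → ℂ → ℂ}

lemma density_toC (hf : HolomorphicDisintegration m Λ d k f p) (hn : n < k) {x : Fin n → ℝ}
    (hx : x ∈ realCube n) : HolomorphicDensity m Λ (d n) (p n (toC x)) :=
  hf.density n hn _ (toC_mem_prefixBox hf.radius_pos hx)

lemma continuousOn_condDensity (hf : HolomorphicDisintegration m Λ d k f p) (hn : n < k)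
    {x : Fin n → ℝ} (hx : x ∈ realCube n) : ContinuousOn (condDensity f n x) (Icc (-1) 1) :=
  (Complex.continuous_re.comp_continuousOn (hf.density_toC hn hx).continuousOn_ofReal).congr
    fun s hs => by simp [hf.eq_ofReal n hn x hx s hs]

lemma condDensity_pos (hf : HolomorphicDisintegration m Λ d k f p) (hn : n < k)
    {x : Fin n → ℝ} (hx : x ∈ realCube n) {s : ℝ} (hs : s ∈ Icc (-1 : ℝ) 1) :
    0 < condDensity f n x s := by
  have hre := (hf.density_toC hn hx).le_re (ofReal_mem_thickening (hf.radius_pos n) hs)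
  rw [hf.eq_ofReal n hn x hx s hs, Complex.ofReal_re] at hre
  linarith [hf.lower_pos]

lemma complexCDF_toC (hf : HolomorphicDisintegration m Λ d k f p) (hn : n < k)
    {x : Fin n → ℝ} (hx : x ∈ realCube n) {s : ℝ} (hs : s ∈ Icc (-1 : ℝ) 1) :
    complexCDF (p n (toC x)) s = condCDF f n x s := by
  rw [complexCDF_ofReal, condCDF, ← intervalIntegral.integral_ofReal]
  refine intervalIntegral.integral_congr fun t ht => ?_
  rw [uIcc_of_le hs.1] at ht
  simp only [hf.eq_ofReal n hn x hx t ⟨ht.1, ht.2.trans hs.2⟩, Complex.ofReal_div,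
    Complex.ofReal_ofNat]

lemma intervalIntegrable_condDensity (hf : HolomorphicDisintegration m Λ d k f p) (hn : n < k)
    {x : Fin n → ℝ} (hx : x ∈ realCube n) :
    IntervalIntegrable (fun t => condDensity f n x t / 2) volume (-1) 1 :=
  ((hf.continuousOn_condDensity hn hx).div_const 2).intervalIntegrable_of_Icc (by norm_num)

lemma condCDF_one (hf : HolomorphicDisintegration m Λ d k f p) (hn : n < k) {x : Fin n → ℝ}
    (hx : x ∈ realCube n) : condCDF f n x 1 = 1 := by
  have hmass : ∫ t, condDensity f n x t ∂unif = 1 := by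
    rw [← Complex.ofReal_inj, ← integral_complex_ofReal, Complex.ofReal_one,
      ← (hf.density_toC hn hx).integral_eq_one]
    exact integral_congr_ae (ae_unif_mem_Icc.mono fun t ht => (hf.eq_ofReal n hn x hx t ht).symm)
  rw [condCDF, intervalIntegral.integral_div, div_eq_inv_mul, ← smul_eq_mul, ← integral_unif, hmass]

lemma mapsTo_condCDF (hf : HolomorphicDisintegration m Λ d k f p) (hn : n < k)
    {x : Fin n → ℝ} (hx : x ∈ realCube n) : MapsTo (condCDF f n x) (Icc (-1) 1) (Icc 0 1) := by
  have hpos : ∀ t ∈ Icc (-1 : ℝ) 1, 0 ≤ condDensity f n x t / 2 := fun t ht =>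
    (half_pos (hf.condDensity_pos hn hx ht)).le
  intro s hs
  constructor
  · exact intervalIntegral.integral_nonneg hs.1 fun t ht => hpos t ⟨ht.1, ht.2.trans hs.2⟩
  · rw [← hf.condCDF_one hn hx]
    refine intervalIntegral.integral_mono_interval le_rfl hs.1 hs.2 ?_
      (hf.intervalIntegrable_condDensity hn hx)
    filter_upwards [ae_restrict_mem measurableSet_Ioc] with t ht
    exact hpos t (Ioc_subset_Icc_self ht)

lemma surjOn_condCDF (hf : HolomorphicDisintegration m Λ d k f p) (hn : n < k)
    {x : Fin n → ℝ} (hx : x ∈ realCube n) : SurjOn (condCDF f n x) (Icc (-1) 1) (Icc 0 1) := by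
  have hcont : ContinuousOn (condCDF f n x) (Icc (-1) 1) := by
    rw [← uIcc_of_le (by norm_num : (-1 : ℝ) ≤ 1)]
    exact intervalIntegral.continuousOn_primitive_interval'
      (hf.intervalIntegrable_condDensity hn hx) left_mem_uIcc
  have hsurj := intermediate_value_Icc (by norm_num) hcont
  rwa [condCDF_neg_one, hf.condCDF_one hn hx] at hsurj

lemma transport_mem_realCube (hf : HolomorphicDisintegration m Λ d k f p)
    (hg : HolomorphicDisintegration m Λ d k g q) (hn : n ≤ k) {x : Fin n → ℝ}
    (hx : x ∈ realCube n) : transport f g n x ∈ realCube n := by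
  induction n with
  | zero => exact fun i => i.elim0
  | succ n ih =>
    have hinit := ih (by lia) (init_mem_realCube hx)
    refine Fin.lastCases ?_ fun i => ?_
    · rw [transport_succ_last]
      exact Function.invFunOn_mem <| hg.surjOn_condCDF hn hinit <|
        hf.mapsTo_condCDF hn (init_mem_realCube hx) (hx (Fin.last n))
    · rw [← init_transport_succ] at hinit
      exact hinit i

lemma condCDF_transport (hf : HolomorphicDisintegration m Λ d k f p)
    (hg : HolomorphicDisintegration m Λ d k g q) (hn : n < k) {x : Fin (n + 1) → ℝ}
    (hx : x ∈ realCube (n + 1)) :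
    condCDF g n (transport f g n (Fin.init x)) (transport f g (n + 1) x (Fin.last n)) =
      condCDF f n (Fin.init x) (x (Fin.last n)) := by
  rw [transport_succ_last]
  exact Function.invFunOn_eq <|
    hg.surjOn_condCDF hn (hf.transport_mem_realCube hg hn.le (init_mem_realCube hx)) <|
      hf.mapsTo_condCDF hn (init_mem_realCube hx) (hx (Fin.last n))

end HolomorphicDisintegration

/-! ### The holomorphic extension of the transport -/

lemma HolomorphicDensity.ne_zero {m Λ r : ℝ} {p : ℂ → ℂ} {s : ℂ}
    (hp : HolomorphicDensity m Λ r p) (hs : s ∈ thickening r realSeg) : p s ≠ 0 :=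
  norm_pos_iff.1 ((half_pos hp.lower_pos).trans_le (hp.half_le_norm hs))

lemma differentiableAt_of_complexCDF_eq {E : Type*} [NormedAddCommGroup E] [NormedSpace ℂ E]
    {m Λ r : ℝ} {q : E → ℂ → ℂ} {h w : E → ℂ} {z₀ : E}
    (hq : ∀ᶠ z in 𝓝 z₀, HolomorphicDensity m Λ r (q z))
    (hw : ∀ᶠ z in 𝓝 z₀, w z ∈ thickening r realSeg)
    (hcdf : DifferentiableAt ℂ (fun v : E × ℂ => complexCDF (q v.1) v.2) (z₀, w z₀))
    (hh : DifferentiableAt ℂ h z₀) (heq : ∀ᶠ z in 𝓝 z₀, complexCDF (q z) (w z) = h z) :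
    DifferentiableAt ℂ w z₀ := by
  have hm := hq.self_of_nhds.lower_pos
  have hcont : ContinuousAt w z₀ := by
    have hgap : ContinuousAt (fun z => (3 / 8 * m)⁻¹ * ‖h z - complexCDF (q z) (w z₀)‖) z₀ :=
      continuousAt_const.mul (hh.continuousAt.sub (ContinuousAt.comp (f := fun z => (z, w z₀))
        hcdf.continuousAt (by fun_prop))).norm
    refine tendsto_iff_norm_sub_tendsto_zero.2 (squeeze_zero' (.of_forall fun z => norm_nonneg _)
      ?_ (hgap.tendsto.trans_eq (by simp [heq.self_of_nhds])))
    filter_upwards [hq, hw, heq] with z hqz hwz hz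
    rw [← hz, ← div_eq_inv_mul, le_div_iff₀' (by positivity)]
    exact hqz.mul_norm_sub_le_norm_complexCDF_sub hwz hw.self_of_nhds
  have hslope : q z₀ (w z₀) / 2 ≠ 0 :=
    div_ne_zero (hq.self_of_nhds.ne_zero hw.self_of_nhds) two_ne_zero
  have hpartial := ((hq.self_of_nhds.hasDerivAt_complexCDF hw.self_of_nhds).sub_const
    (h z₀)).hasFDerivAt_equiv hslope
  exact differentiableAt_of_implicit (H := fun v : E × ℂ => complexCDF (q v.1) v.2 - h v.1)
    (hcdf.sub (hh.comp (f := Prod.fst) (z₀, w z₀) differentiableAt_fst)) hpartial hcont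
    (heq.mono fun z hz => by simp only [hz, heq.self_of_nhds, sub_self])

/-- The Knothe–Rosenblatt transport between the densities whose conditional densities have the
holomorphic extensions `p` and `q`: the distribution function of `q n` is inverted on the
`d n`-neighbourhood of `[-1,1]`. -/
def complexTransport (d : ℕ → ℝ) (p q : ∀ n, (Fin n → ℂ) → ℂ → ℂ) :
    (n : ℕ) → (Fin n → ℂ) → (Fin n → ℂ)
  | 0, z => z
  | n + 1, z =>
      Fin.snoc (α := fun _ => ℂ) (complexTransport d p q n (Fin.init z))
        (Function.invFunOn (complexCDF (q n (complexTransport d p q n (Fin.init z))))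
          (thickening (d n) realSeg) (complexCDF (p n (Fin.init z)) (z (Fin.last n))))

section Recursion

variable (d : ℕ → ℝ) (p q : ∀ n, (Fin n → ℂ) → ℂ → ℂ) (n : ℕ) (z : Fin (n + 1) → ℂ)

lemma complexTransport_succ_last :
    complexTransport d p q (n + 1) z (Fin.last n) =
      Function.invFunOn (complexCDF (q n (complexTransport d p q n (Fin.init z))))
        (thickening (d n) realSeg) (complexCDF (p n (Fin.init z)) (z (Fin.last n))) := by
  simp [complexTransport]

lemma init_complexTransport_succ :
    Fin.init (complexTransport d p q (n + 1) z) = complexTransport d p q n (Fin.init z) := by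
  simp [complexTransport]

lemma complexTransport_succ :
    complexTransport d p q (n + 1) z =
      Fin.snoc (α := fun _ => ℂ) (complexTransport d p q n (Fin.init z))
        (complexTransport d p q (n + 1) z (Fin.last n)) := by
  rw [← init_complexTransport_succ, Fin.snoc_init_self]

end Recursion

lemma init_mem_prefixBox {d : ℕ → ℝ} {n : ℕ} {z : Fin (n + 1) → ℂ}
    (hz : z ∈ prefixBox d (n + 1)) : Fin.init z ∈ prefixBox d n :=
  fun i => hz i.castSucc

lemma differentiable_init {n : ℕ} :
    Differentiable ℂ (Fin.init : (Fin (n + 1) → ℂ) → Fin n → ℂ) :=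
  differentiable_pi.2 fun i => differentiable_apply i.castSucc

namespace HolomorphicDisintegration

variable {m Λ c : ℝ} {d : ℕ → ℝ} {k n : ℕ} {f g : (ℕ → ℝ) → ℝ} {p q : ∀ n, (Fin n → ℂ) → ℂ → ℂ}

lemma differentiableOn_complexCDF (hf : HolomorphicDisintegration m Λ d k f p) (hn : n < k) :
    DifferentiableOn ℂ (fun w : (Fin n → ℂ) × ℂ => complexCDF (p n w.1) w.2)
      (prefixBox d n ×ˢ thickening (d n) realSeg) :=
  KnotheRosenblatt.differentiableOn_complexCDF (isOpen_nbhdBox _) isOpen_thickening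
    (convex_realSeg.thickening _)
    (by simpa using ofReal_mem_thickening (hf.radius_pos n) (x := -1) (by norm_num))
    (hf.differentiableOn n hn) fun z hz _ hs => (hf.density n hn z hz).norm_le hs

lemma differentiableAt_complexCDF (hf : HolomorphicDisintegration m Λ d k f p) (hn : n < k)
    {z : Fin n → ℂ} {s : ℂ} (hz : z ∈ prefixBox d n) (hs : s ∈ thickening (d n) realSeg) :
    DifferentiableAt ℂ (fun w : (Fin n → ℂ) × ℂ => complexCDF (p n w.1) w.2) (z, s) :=
  (hf.differentiableOn_complexCDF hn).differentiableAt
    (((isOpen_nbhdBox _).prod isOpen_thickening).mem_nhds ⟨hz, hs⟩)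

lemma norm_complexCDF_sub_toC_le (hf : HolomorphicDisintegration m Λ d k f p) (hn : n < k)
    {z : Fin n → ℂ} {x : Fin n → ℝ} (hx : x ∈ realCube n) (hzx : ∀ i, ‖z i - x i‖ < d i)
    {s : ℝ} (hs : s ∈ Icc (-1) 1) :
    ‖complexCDF (p n z) s - complexCDF (p n (toC x)) s‖ ≤ m / 64 * min 1 (d n) :=
  norm_complexCDF_sub_complexCDF_le
    (hf.density n hn z (mem_prefixBox_of_near hx hzx)).continuousOn_ofReal
    (hf.density_toC hn hx).continuousOn_ofReal (hf.norm_sub_le n hn z x hx hzx) hs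

lemma norm_complexCDF_sub_complexCDF_le (hf : HolomorphicDisintegration m Λ d k f p)
    (hg : HolomorphicDisintegration m Λ d k g q) (hn : n < k) {z w : Fin n → ℂ}
    {x y : Fin n → ℝ} (hx : x ∈ realCube n) (hzx : ∀ i, ‖z i - x i‖ < d i)
    (hy : y ∈ realCube n) (hwy : ∀ i, ‖w i - y i‖ < d i) {s : ℂ}
    (hs : s ∈ thickening (d n) realSeg) {σ τ : ℝ} (hσ : σ ∈ Icc (-1) 1) (hτ : τ ∈ Icc (-1) 1)
    (heq : condCDF g n y τ = condCDF f n x σ) :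
    ‖complexCDF (p n z) s - complexCDF (q n w) τ‖ ≤ m / 32 * min 1 (d n) + Λ * ‖s - σ‖ := by
  have hcdf : complexCDF (q n (toC y)) τ = complexCDF (p n (toC x)) σ := by
    rw [hf.complexCDF_toC hn hx hσ, hg.complexCDF_toC hn hy hτ, heq]
  have hlast := (hf.density n hn z (mem_prefixBox_of_near hx hzx)).norm_complexCDF_sub_le hs
    (ofReal_mem_thickening (hf.radius_pos n) hσ)
  have hsource := hf.norm_complexCDF_sub_toC_le hn hx hzx hσ
  have htarget := hg.norm_complexCDF_sub_toC_le hn hy hwy hτ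
  rw [hcdf, norm_sub_rev] at htarget
  have := norm_sub_le_norm_sub_add_norm_sub (complexCDF (p n z) s) (complexCDF (p n z) σ)
    (complexCDF (q n w) τ)
  have := norm_sub_le_norm_sub_add_norm_sub (complexCDF (p n z) σ) (complexCDF (p n (toC x)) σ)
    (complexCDF (q n w) τ)
  linarith

lemma mul_radius_le (hf : HolomorphicDisintegration m Λ d k f p) (hc : Λ * c ≤ m / 32) (i : ℕ) :
    c * d i ≤ d i := by
  have hΛ := hf.lower_pos.trans_le hf.lower_le_upper
  have : c ≤ 1 := le_of_mul_le_mul_left (by linarith [hf.lower_le_upper]) hΛ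
  nlinarith [hf.radius_pos i]

lemma prefixBox_mul_subset (hf : HolomorphicDisintegration m Λ d k f p) (hc : Λ * c ≤ m / 32) :
    prefixBox (fun i => c * d i) n ⊆ prefixBox d n :=
  fun _ hz i => thickening_mono (hf.mul_radius_le hc i) _ (hz i)

lemma defect_le (hf : HolomorphicDisintegration m Λ d k f p) (hc : Λ * c ≤ m / 32) {t : ℝ}
    (ht : t < c * d n) : m / 32 * min 1 (d n) + Λ * t ≤ 3 / 8 * m * (d n / 4) := by
  have hm := hf.lower_pos
  have hd := hf.radius_pos n
  calc m / 32 * min 1 (d n) + Λ * t ≤ m / 32 * d n + Λ * (c * d n) := by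
        have hΛ := hm.trans_le hf.lower_le_upper
        gcongr
        exact min_le_right _ _
    _ ≤ m / 32 * d n + m / 32 * d n := by rw [← mul_assoc]; gcongr
    _ ≤ 3 / 8 * m * (d n / 4) := by linarith [mul_pos hm hd]

lemma norm_complexCDF_sub_complexCDF_transport_le (hf : HolomorphicDisintegration m Λ d k f p)
    (hg : HolomorphicDisintegration m Λ d k g q) (hn : n < k) {z : Fin (n + 1) → ℂ}
    {x : Fin (n + 1) → ℝ} (hx : x ∈ realCube (n + 1)) (hzx : ∀ i, ‖z i - x i‖ < d i)
    {w : Fin n → ℂ} (hw : ∀ i, ‖w i - transport f g n (Fin.init x) i‖ < d i) :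
    ‖complexCDF (p n (Fin.init z)) (z (Fin.last n)) -
        complexCDF (q n w) (transport f g (n + 1) x (Fin.last n))‖ ≤
      m / 32 * min 1 (d n) + Λ * ‖z (Fin.last n) - x (Fin.last n)‖ :=
  hf.norm_complexCDF_sub_complexCDF_le hg hn (init_mem_realCube hx) (fun i => hzx i.castSucc)
    (hf.transport_mem_realCube hg hn.le (init_mem_realCube hx)) hw
    (mem_thickening_realSeg.2 ⟨_, hx (Fin.last n), hzx (Fin.last n)⟩) (hx (Fin.last n))
    (hf.transport_mem_realCube hg hn hx (Fin.last n)) (hf.condCDF_transport hg hn hx)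

lemma exists_mem_complexCDF_eq (hf : HolomorphicDisintegration m Λ d k f p)
    (hg : HolomorphicDisintegration m Λ d k g q) (hc : Λ * c ≤ m / 32) (hn : n < k)
    {z : Fin (n + 1) → ℂ} {x : Fin (n + 1) → ℝ} (hx : x ∈ realCube (n + 1))
    (hzx : ∀ i, ‖z i - x i‖ < c * d i)
    {w : Fin n → ℂ} (hw : ∀ i, ‖w i - transport f g n (Fin.init x) i‖ < d i) :
    ∃ u ∈ thickening (d n) realSeg,
      complexCDF (q n w) u = complexCDF (p n (Fin.init z)) (z (Fin.last n)) := by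
  have hd := hf.radius_pos n
  refine (hg.density n hn w (mem_prefixBox_of_near
    (hf.transport_mem_realCube hg hn.le (init_mem_realCube hx)) hw)).exists_mem_complexCDF_eq
    (hf.transport_mem_realCube hg hn hx (Fin.last n)) (ρ := d n / 4) (by linarith) (by linarith)
    ((hf.norm_complexCDF_sub_complexCDF_transport_le hg hn hx
      (fun i => (hzx i).trans_le (hf.mul_radius_le hc i)) hw).trans
        (hf.defect_le hc (hzx (Fin.last n))))

lemma complexTransport_last_mem {z : Fin (n + 1) → ℂ} (h : ∃ u ∈ thickening (d n) realSeg,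
      complexCDF (q n (complexTransport d p q n (Fin.init z))) u =
        complexCDF (p n (Fin.init z)) (z (Fin.last n))) :
    complexTransport d p q (n + 1) z (Fin.last n) ∈ thickening (d n) realSeg := by
  rw [complexTransport_succ_last]
  exact Function.invFunOn_mem h

lemma complexCDF_complexTransport_last {z : Fin (n + 1) → ℂ} (h : ∃ u ∈ thickening (d n) realSeg,
      complexCDF (q n (complexTransport d p q n (Fin.init z))) u =
        complexCDF (p n (Fin.init z)) (z (Fin.last n))) :
    complexCDF (q n (complexTransport d p q n (Fin.init z)))
        (complexTransport d p q (n + 1) z (Fin.last n)) =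
      complexCDF (p n (Fin.init z)) (z (Fin.last n)) := by
  rw [complexTransport_succ_last]
  exact Function.invFunOn_eq h

lemma lt_half_radius_of_le (hf : HolomorphicDisintegration m Λ d k f p) (hc : Λ * c ≤ m / 32)
    {t u : ℝ} (ht : t < c * d n) (hu : 3 / 8 * m * u ≤ m / 32 * min 1 (d n) + Λ * t) :
    u < d n / 2 := by
  have hm := hf.lower_pos
  have : u ≤ d n / 4 :=
    le_of_mul_le_mul_left (hu.trans (hf.defect_le hc ht)) (by positivity)
  linarith [hf.radius_pos n]

theorem norm_complexTransport_sub_transport_le (hf : HolomorphicDisintegration m Λ d k f p)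
    (hg : HolomorphicDisintegration m Λ d k g q) (hc : Λ * c ≤ m / 32) (hn : n ≤ k)
    {z : Fin n → ℂ} {x : Fin n → ℝ} (hx : x ∈ realCube n) (hzx : ∀ i, ‖z i - x i‖ < c * d i)
    (i : Fin n) :
    3 / 8 * m * ‖complexTransport d p q n z i - transport f g n x i‖ ≤
      m / 32 * min 1 (d i) + Λ * ‖z i - x i‖ := by
  induction n with
  | zero => exact i.elim0
  | succ n ih =>
    have hinit := ih (by lia) (init_mem_realCube hx) (z := Fin.init z) fun i => hzx i.castSucc
    have hnear : ∀ i, ‖complexTransport d p q n (Fin.init z) i -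
        transport f g n (Fin.init x) i‖ < d i := fun i =>
      (hf.lt_half_radius_of_le hc (hzx i.castSucc) (hinit i)).trans
        (half_lt_self (hf.radius_pos i))
    refine Fin.lastCases ?_ (fun i => ?_) i
    · have hsolution := hf.exists_mem_complexCDF_eq hg hc hn hx hzx hnear
      have hdefect := hf.norm_complexCDF_sub_complexCDF_transport_le hg hn hx
        (fun i => (hzx i).trans_le (hf.mul_radius_le hc i)) hnear
      rw [← complexCDF_complexTransport_last hsolution] at hdefect
      have hT := hf.transport_mem_realCube hg hn hx (Fin.last n)
      exact ((hg.density n hn _ (mem_prefixBox_of_near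
        (hf.transport_mem_realCube hg (by lia) (init_mem_realCube hx))
        hnear)).mul_norm_sub_le_norm_complexCDF_sub (complexTransport_last_mem hsolution)
          (ofReal_mem_thickening (hf.radius_pos n) hT)).trans hdefect
    · rw [← init_complexTransport_succ, ← init_transport_succ] at hinit
      exact hinit i

lemma norm_complexTransport_sub_transport_lt (hf : HolomorphicDisintegration m Λ d k f p)
    (hg : HolomorphicDisintegration m Λ d k g q) (hc : Λ * c ≤ m / 32) (hn : n ≤ k)
    {z : Fin n → ℂ} {x : Fin n → ℝ} (hx : x ∈ realCube n) (hzx : ∀ i, ‖z i - x i‖ < c * d i)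
    (i : Fin n) : ‖complexTransport d p q n z i - transport f g n x i‖ < d i / 2 :=
  hf.lt_half_radius_of_le hc (hzx i)
    (hf.norm_complexTransport_sub_transport_le hg hc hn hx hzx i)

lemma complexTransport_mem_prefixBox (hf : HolomorphicDisintegration m Λ d k f p)
    (hg : HolomorphicDisintegration m Λ d k g q) (hc : Λ * c ≤ m / 32) (hn : n ≤ k)
    {z : Fin n → ℂ} (hz : z ∈ prefixBox (fun i => c * d i) n) :
    complexTransport d p q n z ∈ prefixBox d n := by
  obtain ⟨x, hx, hzx⟩ := exists_near_of_mem_prefixBox hz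
  exact mem_prefixBox_of_near (hf.transport_mem_realCube hg hn hx) fun i =>
    (hf.norm_complexTransport_sub_transport_lt hg hc hn hx hzx i).trans
      (half_lt_self (hf.radius_pos i))

lemma complexCDF_complexTransport (hf : HolomorphicDisintegration m Λ d k f p)
    (hg : HolomorphicDisintegration m Λ d k g q) (hc : Λ * c ≤ m / 32) (hn : n < k)
    {z : Fin (n + 1) → ℂ} (hz : z ∈ prefixBox (fun i => c * d i) (n + 1)) :
    complexCDF (q n (complexTransport d p q n (Fin.init z)))
        (complexTransport d p q (n + 1) z (Fin.last n)) =
      complexCDF (p n (Fin.init z)) (z (Fin.last n)) := by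
  obtain ⟨x, hx, hzx⟩ := exists_near_of_mem_prefixBox hz
  exact complexCDF_complexTransport_last <| hf.exists_mem_complexCDF_eq hg hc hn hx hzx fun i =>
    (hf.norm_complexTransport_sub_transport_lt hg hc hn.le (init_mem_realCube hx)
      (fun i => hzx i.castSucc) i).trans (half_lt_self (hf.radius_pos i))

lemma complexTransport_toC (hf : HolomorphicDisintegration m Λ d k f p)
    (hg : HolomorphicDisintegration m Λ d k g q) (hn : n ≤ k) {x : Fin n → ℝ}
    (hx : x ∈ realCube n) : complexTransport d p q n (toC x) = toC (transport f g n x) := by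
  induction n with
  | zero => exact Subsingleton.elim _ _
  | succ n ih =>
    have hx' := init_mem_realCube hx
    have hT := hf.transport_mem_realCube hg hn hx (Fin.last n)
    have hTinit := hf.transport_mem_realCube hg (by lia) hx'
    have hinit : complexTransport d p q n (Fin.init (toC x)) =
        toC (transport f g n (Fin.init x)) := ih (by lia) hx'
    have hTmem := ofReal_mem_thickening (hf.radius_pos n) hT
    have hsolution : complexCDF (q n (complexTransport d p q n (Fin.init (toC x))))
        (transport f g (n + 1) x (Fin.last n) : ℝ) =
        complexCDF (p n (Fin.init (toC x))) (toC x (Fin.last n)) := by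
      rw [hinit, hg.complexCDF_toC hn hTinit hT, hf.condCDF_transport hg hn hx]
      exact (hf.complexCDF_toC hn hx' (hx (Fin.last n))).symm
    have hlast : complexTransport d p q (n + 1) (toC x) (Fin.last n) =
        (transport f g (n + 1) x (Fin.last n) : ℝ) := by
      have hinj := (hg.density_toC hn hTinit).injOn_complexCDF
      rw [← hinit] at hinj
      exact hinj (complexTransport_last_mem ⟨_, hTmem, hsolution⟩) hTmem
        ((complexCDF_complexTransport_last ⟨_, hTmem, hsolution⟩).trans hsolution.symm)
    rw [complexTransport_succ, hinit, hlast, ← toC_snoc, ← init_transport_succ,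
      Fin.snoc_init_self]

lemma differentiableAt_complexTransport_last (hf : HolomorphicDisintegration m Λ d k f p)
    (hg : HolomorphicDisintegration m Λ d k g q) (hc : Λ * c ≤ m / 32) (hn : n < k)
    {z : Fin (n + 1) → ℂ} (hz : z ∈ prefixBox (fun i => c * d i) (n + 1))
    (hinit : DifferentiableAt ℂ (fun z => complexTransport d p q n (Fin.init z)) z) :
    DifferentiableAt ℂ (fun z => complexTransport d p q (n + 1) z (Fin.last n)) z := by
  have hnhds : ∀ᶠ z in 𝓝 z, z ∈ prefixBox (fun i => c * d i) (n + 1) :=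
    (isOpen_nbhdBox _).mem_nhds hz
  have hmem : ∀ {z}, z ∈ prefixBox (fun i => c * d i) (n + 1) →
      complexTransport d p q n (Fin.init z) ∈ prefixBox d n := fun hz =>
    hf.complexTransport_mem_prefixBox hg hc hn.le (init_mem_prefixBox hz)
  have hlast : ∀ {z}, z ∈ prefixBox (fun i => c * d i) (n + 1) →
      complexTransport d p q (n + 1) z (Fin.last n) ∈ thickening (d n) realSeg := fun hz =>
    hf.complexTransport_mem_prefixBox hg hc hn hz (Fin.last n)
  have hz' : z ∈ prefixBox d (n + 1) := hf.prefixBox_mul_subset hc hz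
  refine differentiableAt_of_complexCDF_eq
    (hnhds.mono fun z hz => hg.density n hn _ (hmem hz)) (hnhds.mono fun z hz => hlast hz) ?_
    ((hf.differentiableAt_complexCDF hn (init_mem_prefixBox hz') (hz' (Fin.last n))).comp
      (f := fun z => (Fin.init z, z (Fin.last n))) z
      (differentiable_init.differentiableAt.prodMk (differentiableAt_apply _ _)))
    (hnhds.mono fun z hz => hf.complexCDF_complexTransport hg hc hn hz)
  exact (hg.differentiableAt_complexCDF hn (hmem hz) (hlast hz)).comp
    (f := fun v : (Fin (n + 1) → ℂ) × ℂ => (complexTransport d p q n (Fin.init v.1), v.2))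
    (z, complexTransport d p q (n + 1) z (Fin.last n))
    ((hinit.comp (f := Prod.fst) (z, _) differentiableAt_fst).prodMk differentiableAt_snd)

theorem differentiableOn_complexTransport (hf : HolomorphicDisintegration m Λ d k f p)
    (hg : HolomorphicDisintegration m Λ d k g q) (hc : Λ * c ≤ m / 32) (hn : n ≤ k) :
    DifferentiableOn ℂ (complexTransport d p q n) (prefixBox (fun i => c * d i) n) := by
  induction n with
  | zero => exact differentiable_of_subsingleton.differentiableOn
  | succ n ih =>
    intro z hz
    have hinit : DifferentiableAt ℂ (fun z => complexTransport d p q n (Fin.init z)) z :=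
      ((ih (by lia)).differentiableAt
        ((isOpen_nbhdBox _).mem_nhds (init_mem_prefixBox hz))).comp (f := Fin.init) z
        differentiable_init.differentiableAt
    have hlast := hf.differentiableAt_complexTransport_last hg hc hn hz hinit
    rw [funext (complexTransport_succ d p q n)]
    exact (differentiable_snoc.differentiableAt.comp z
      (hinit.prodMk hlast)).differentiableWithinAt

end HolomorphicDisintegration

/-! ### The derivative in the last variable -/

lemma le_re_div {a b : ℝ} (ha : 0 < a) {p q : ℂ} (hp : 3 * a ≤ p.re) (hp' : |p.im| ≤ a)
    (hq : 3 * a ≤ q.re) (hq' : |q.im| ≤ a) (hb : ‖q‖ ≤ b) :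
    8 * a ^ 2 / b ^ 2 ≤ (p / q).re := by
  have hnorm : 0 < Complex.normSq q := Complex.normSq_pos.2 fun h => by simp [h] at hq; linarith
  have hnorm_le : Complex.normSq q ≤ b ^ 2 := by
    rw [Complex.normSq_eq_norm_sq]
    gcongr
  have hre : 9 * a ^ 2 ≤ p.re * q.re := by nlinarith
  have him : -a ^ 2 ≤ p.im * q.im := by
    have : |p.im * q.im| ≤ a * a := by rw [abs_mul]; gcongr
    linarith [neg_abs_le (p.im * q.im)]
  rw [Complex.div_re, ← add_div]
  exact div_le_div₀ (by linarith [sq_nonneg a]) (by linarith) hnorm hnorm_le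

/-- The partial derivative of the last component of `complexTransport d p q (n + 1)` in its last
variable, namely the quotient of the two conditional densities. -/
def transportDeriv (d : ℕ → ℝ) (p q : ∀ n, (Fin n → ℂ) → ℂ → ℂ) (n : ℕ) (z : Fin (n + 1) → ℂ) :
    ℂ :=
  p n (Fin.init z) (z (Fin.last n)) /
    q n (complexTransport d p q n (Fin.init z)) (complexTransport d p q (n + 1) z (Fin.last n))

lemma toC_update {ι : Type*} [DecidableEq ι] (x : ι → ℝ) (i : ι) (t : ℝ) :
    toC (Function.update x i t) = Function.update (toC x) i (t : ℂ) :=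
  Function.comp_update Complex.ofReal x i t

lemma update_mem_realCube {n : ℕ} {x : Fin n → ℝ} (hx : x ∈ realCube n) (i : Fin n) {t : ℝ}
    (ht : t ∈ Icc (-1) 1) : Function.update x i t ∈ realCube n := fun j => by
  rcases eq_or_ne j i with rfl | hj
  · simpa using ht
  · simpa [hj] using hx j

namespace HolomorphicDisintegration

variable {m Λ c : ℝ} {d : ℕ → ℝ} {k n : ℕ} {f g : (ℕ → ℝ) → ℝ} {p q : ∀ n, (Fin n → ℂ) → ℂ → ℂ}

lemma complexTransport_init_mem_prefixBox (hf : HolomorphicDisintegration m Λ d k f p)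
    (hg : HolomorphicDisintegration m Λ d k g q) (hc : Λ * c ≤ m / 32) (hn : n < k)
    {z : Fin (n + 1) → ℂ} (hz : z ∈ prefixBox (fun i => c * d i) (n + 1)) :
    complexTransport d p q n (Fin.init z) ∈ prefixBox d n :=
  hf.complexTransport_mem_prefixBox hg hc hn.le (init_mem_prefixBox hz)

lemma density_init (hf : HolomorphicDisintegration m Λ d k f p) (hc : Λ * c ≤ m / 32)
    (hn : n < k) {z : Fin (n + 1) → ℂ} (hz : z ∈ prefixBox (fun i => c * d i) (n + 1)) :
    HolomorphicDensity m Λ (d n) (p n (Fin.init z)) :=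
  hf.density n hn _ (init_mem_prefixBox (hf.prefixBox_mul_subset hc hz))

lemma density_complexTransport_init (hf : HolomorphicDisintegration m Λ d k f p)
    (hg : HolomorphicDisintegration m Λ d k g q) (hc : Λ * c ≤ m / 32) (hn : n < k)
    {z : Fin (n + 1) → ℂ} (hz : z ∈ prefixBox (fun i => c * d i) (n + 1)) :
    HolomorphicDensity m Λ (d n) (q n (complexTransport d p q n (Fin.init z))) :=
  hg.density n hn _ (hf.complexTransport_init_mem_prefixBox hg hc hn hz)

lemma hasDerivAt_complexTransport_last (hf : HolomorphicDisintegration m Λ d k f p)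
    (hg : HolomorphicDisintegration m Λ d k g q) (hc : Λ * c ≤ m / 32) (hn : n < k)
    {z : Fin (n + 1) → ℂ} (hz : z ∈ prefixBox (fun i => c * d i) (n + 1)) :
    HasDerivAt
      (fun s => complexTransport d p q (n + 1) (Function.update z (Fin.last n) s) (Fin.last n))
      (transportDeriv d p q n z) (z (Fin.last n)) := by
  set S := fun s => complexTransport d p q (n + 1) (Function.update z (Fin.last n) s) (Fin.last n)
    with hS
  have hp := hf.density_init hc hn hz
  have hs := hf.prefixBox_mul_subset hc hz (Fin.last n)
  have hq := hf.density_complexTransport_init hg hc hn hz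
  have hSs := hf.complexTransport_mem_prefixBox hg hc hn hz (Fin.last n)
  have hSz : S (z (Fin.last n)) = complexTransport d p q (n + 1) z (Fin.last n) := by
    simp only [hS, Function.update_eq_self]
  have hdiff : DifferentiableAt ℂ S (z (Fin.last n)) := by
    have hT : DifferentiableAt ℂ (complexTransport d p q (n + 1))
        (Function.update z (Fin.last n) (z (Fin.last n))) := by
      rw [Function.update_eq_self]
      exact (hf.differentiableOn_complexTransport hg hc hn).differentiableAt
        ((isOpen_nbhdBox _).mem_nhds hz)
    exact differentiableAt_pi.1
      (hT.comp _ (hasDerivAt_update z (Fin.last n) _).differentiableAt) (Fin.last n)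
  have heq : complexCDF (q n (complexTransport d p q n (Fin.init z))) ∘ S
      =ᶠ[𝓝 (z (Fin.last n))] complexCDF (p n (Fin.init z)) := by
    have hmem : ∀ᶠ s in 𝓝 (z (Fin.last n)),
        Function.update z (Fin.last n) s ∈ prefixBox (fun i => c * d i) (n + 1) :=
      (continuous_const.update (Fin.last n) continuous_id).tendsto' _ z (by simp)
        |>.eventually ((isOpen_nbhdBox _).mem_nhds hz)
    filter_upwards [hmem] with s hs
    simpa using hf.complexCDF_complexTransport hg hc hn hs
  have hchain := (hq.hasDerivAt_complexCDF hSs).comp_of_eq _ hdiff.hasDerivAt hSz.symm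
  have hslope := hchain.unique ((hp.hasDerivAt_complexCDF hs).congr_of_eventuallyEq heq)
  have hderiv : transportDeriv d p q n z = deriv S (z (Fin.last n)) := by
    rw [transportDeriv, div_eq_iff (hq.ne_zero hSs)]
    linear_combination -2 * hslope
  exact hderiv ▸ hdiff.hasDerivAt

lemma transportDeriv_toC (hf : HolomorphicDisintegration m Λ d k f p)
    (hg : HolomorphicDisintegration m Λ d k g q) (hn : n < k) {x : Fin (n + 1) → ℝ}
    (hx : x ∈ realCube (n + 1)) :
    transportDeriv d p q n (toC x) =
      (condDensity f n (Fin.init x) (x (Fin.last n)) /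
        condDensity g n (transport f g n (Fin.init x)) (transportComp f g n x) : ℝ) := by
  have hx' := init_mem_realCube hx
  rw [Complex.ofReal_div, ← hf.eq_ofReal n hn _ hx' _ (hx (Fin.last n)), transportComp,
    ← hg.eq_ofReal n hn _ (hf.transport_mem_realCube hg hn.le hx') _
      (hf.transport_mem_realCube hg hn hx (Fin.last n)),
    ← hf.complexTransport_toC hg hn.le hx', transportDeriv, hf.complexTransport_toC hg hn hx]
  rfl

theorem extendsLastPartial_transportDeriv (hf : HolomorphicDisintegration m Λ d k f p)
    (hg : HolomorphicDisintegration m Λ d k g q) (hc : Λ * c ≤ m / 32) (hc₀ : 0 < c)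
    (hn : n < k) : ExtendsLastPartial (transportComp f g n) (transportDeriv d p q n) := by
  intro x hx
  have hreal : ∀ t ∈ Icc (-1 : ℝ) 1,
      transportComp f g n (Function.update x (Fin.last n) t) = (complexTransport d p q (n + 1)
        (Function.update (toC x) (Fin.last n) t) (Fin.last n)).re := fun t ht => by
    rw [← toC_update, hf.complexTransport_toC hg hn (update_mem_realCube hx _ ht)]
    rfl
  have hderiv := (hf.hasDerivAt_complexTransport_last hg hc hn (toC_mem_prefixBox
    (fun i => mul_pos hc₀ (hf.radius_pos i)) hx)).real_of_complex (z := x (Fin.last n))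
  rw [hf.transportDeriv_toC hg hn hx, Complex.ofReal_re] at hderiv
  exact ⟨_, hf.transportDeriv_toC hg hn hx,
    hderiv.hasDerivWithinAt.congr hreal (hreal _ (hx (Fin.last n)))⟩

theorem differentiableOn_transportDeriv (hf : HolomorphicDisintegration m Λ d k f p)
    (hg : HolomorphicDisintegration m Λ d k g q) (hc : Λ * c ≤ m / 32) (hn : n < k) :
    DifferentiableOn ℂ (transportDeriv d p q n) (prefixBox (fun i => c * d i) (n + 1)) := by
  have hT := hf.differentiableOn_complexTransport hg hc hn.le
  have hTlast := differentiableOn_pi.1 (hf.differentiableOn_complexTransport hg hc hn) (Fin.last n)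
  have hTinit : DifferentiableOn ℂ (fun z => complexTransport d p q n (Fin.init z))
      (prefixBox (fun i => c * d i) (n + 1)) :=
    hT.comp differentiable_init.differentiableOn fun z hz => init_mem_prefixBox hz
  have hsource : DifferentiableOn ℂ (fun z => p n (Fin.init z) (z (Fin.last n)))
      (prefixBox (fun i => c * d i) (n + 1)) :=
    (hf.differentiableOn n hn).comp
      (differentiable_init.prodMk (differentiable_apply (Fin.last n))).differentiableOn
      fun z hz => ⟨init_mem_prefixBox (hf.prefixBox_mul_subset hc hz),
        hf.prefixBox_mul_subset hc hz (Fin.last n)⟩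
  have htarget : DifferentiableOn ℂ (fun z => q n (complexTransport d p q n (Fin.init z))
      (complexTransport d p q (n + 1) z (Fin.last n))) (prefixBox (fun i => c * d i) (n + 1)) :=
    (hg.differentiableOn n hn).comp (hTinit.prodMk hTlast) fun z hz =>
      ⟨hf.complexTransport_init_mem_prefixBox hg hc hn hz,
        hf.complexTransport_mem_prefixBox hg hc hn hz (Fin.last n)⟩
  refine (hsource.mul (htarget.fun_inv fun z hz => ?_)).congr fun z _ => div_eq_mul_inv _ _
  exact (hf.density_complexTransport_init hg hc hn hz).ne_zero
    (hf.complexTransport_mem_prefixBox hg hc hn hz (Fin.last n))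

lemma norm_transportDeriv_le (hf : HolomorphicDisintegration m Λ d k f p)
    (hg : HolomorphicDisintegration m Λ d k g q) (hc : Λ * c ≤ m / 32) (hn : n < k)
    {z : Fin (n + 1) → ℂ} (hz : z ∈ prefixBox (fun i => c * d i) (n + 1)) :
    ‖transportDeriv d p q n z‖ ≤ 4 * (Λ / m) := by
  have hp := hf.density_init hc hn hz
  have hs := hf.prefixBox_mul_subset hc hz (Fin.last n)
  have hq := hf.density_complexTransport_init hg hc hn hz
  have ht := hf.complexTransport_mem_prefixBox hg hc hn hz (Fin.last n)
  have hm := hf.lower_pos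
  rw [transportDeriv, norm_div]
  calc _ ≤ 2 * Λ / (m / 2) :=
        div_le_div₀ (by linarith [hf.lower_le_upper]) (hp.norm_le hs) (half_pos hm)
          (hq.half_le_norm ht)
    _ = 4 * (Λ / m) := by field_simp; ring

lemma le_re_transportDeriv (hf : HolomorphicDisintegration m Λ d k f p)
    (hg : HolomorphicDisintegration m Λ d k g q) (hc : Λ * c ≤ m / 32) (hn : n < k)
    {z : Fin (n + 1) → ℂ} (hz : z ∈ prefixBox (fun i => c * d i) (n + 1)) :
    1 / (8 * (Λ / m) ^ 2) ≤ (transportDeriv d p q n z).re := by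
  have hp := hf.density_init hc hn hz
  have hs := hf.prefixBox_mul_subset hc hz (Fin.last n)
  have hq := hf.density_complexTransport_init hg hc hn hz
  have ht := hf.complexTransport_mem_prefixBox hg hc hn hz (Fin.last n)
  have hm := hf.lower_pos
  have hΛ := hm.trans_le hf.lower_le_upper
  calc 1 / (8 * (Λ / m) ^ 2) = 8 * (m / 4) ^ 2 / (2 * Λ) ^ 2 := by field_simp; ring
    _ ≤ _ := le_re_div (by positivity) (by linarith [hp.le_re hs]) (hp.abs_im_le hs)
        (by linarith [hq.le_re ht]) (hq.abs_im_le ht) (hq.norm_le ht)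

lemma norm_transportDeriv_snoc_sub_one_le (hf : HolomorphicDisintegration m Λ d k f p)
    (hg : HolomorphicDisintegration m Λ d k g q) (hc : Λ * c ≤ m / 32) (hc₀ : 0 < c)
    (hn : n < k) {z : Fin n → ℂ} (hz : z ∈ prefixBox (fun i => c * d i) n) {s : ℂ}
    (hs : s ∈ realSeg) :
    ‖transportDeriv d p q n (Fin.snoc (α := fun _ => ℂ) z s) - 1‖ ≤ 96 * (Λ / m) / d n := by
  obtain ⟨σ, hσ, rfl⟩ := hs
  obtain ⟨x, hx, hzx⟩ := exists_near_of_mem_prefixBox hz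
  have hm := hf.lower_pos
  have hd := hf.radius_pos n
  have hy := snoc_mem_realCube hx hσ
  have hwy : ∀ i : Fin (n + 1), ‖(Fin.snoc z (σ : ℂ) : Fin (n + 1) → ℂ) i -
      (Fin.snoc x σ : Fin (n + 1) → ℝ) i‖ < c * d i :=
    Fin.lastCases (by simpa using mul_pos hc₀ hd) fun i => by simpa using hzx i
  have hw := mem_prefixBox_of_near (d := fun i => c * d i) hy hwy
  have hdefect := hf.norm_complexTransport_sub_transport_le hg hc hn hy hwy (Fin.last n)
  have hhalf := hf.norm_complexTransport_sub_transport_lt hg hc hn hy hwy (Fin.last n)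
  simp only [Fin.snoc_last, sub_self, norm_zero, mul_zero, add_zero, Fin.val_last]
    at hdefect hhalf
  have hq := hf.density_complexTransport_init hg hc hn hw
  have ht := hf.complexTransport_mem_prefixBox hg hc hn hw (Fin.last n)
  have hone := hdefect.trans (mul_le_of_le_one_right (by positivity) (min_le_left 1 (d n)))
  have hsource := (hf.density_init hc hn hw).norm_sub_one_le (s := σ) hσ
    (by simpa using hd) (by simp)
  have htarget := hq.norm_sub_one_le (hf.transport_mem_realCube hg hn hy (Fin.last n)) hhalf
    (le_of_mul_le_mul_left (a := 3 / 8 * m) (by linarith) (by positivity))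
  rw [norm_sub_rev] at htarget
  rw [transportDeriv, Fin.snoc_last, div_sub_one (hq.ne_zero ht), norm_div]
  have hΛ := hm.trans_le hf.lower_le_upper
  calc _ ≤ (24 * Λ / d n + 24 * Λ / d n) / (m / 2) := by
        gcongr
        · exact (norm_sub_le_norm_sub_add_norm_sub _ 1 _).trans (add_le_add hsource htarget)
        · exact hq.half_le_norm ht
    _ = 96 * (Λ / m) / d n := by field_simp; ring

end HolomorphicDisintegration

lemma exists_pos_seq_extending {k : ℕ} {δ : Fin k → ℝ} (hδ : ∀ i, 0 < δ i) :
    ∃ d : ℕ → ℝ, (∀ i, 0 < d i) ∧ (fun i : Fin k => d i) = δ := by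
  refine ⟨fun i => if h : i < k then δ ⟨i, h⟩ else 1, fun i => ?_, by simp⟩
  dsimp only
  split_ifs with h
  exacts [hδ ⟨i, h⟩, one_pos]

end KnotheRosenblatt

end

open KnotheRosenblatt in
theorem mainTheorem7 (M L : ℝ) (hM : 0 < M) (hML : M ≤ L) :
    ∃ C₆ C₇ C₈ : ℝ, 0 < C₆ ∧ C₆ ≤ 1 ∧ 0 < C₇ ∧ C₇ ≤ 1 ∧ 0 < C₈ ∧
      ∀ (k : ℕ) (δ : Fin k → ℝ), (∀ i, 0 < δ i) →
      ∀ fρ fπ : (ℕ → ℂ) → ℂ, Admissible M L C₆ δ fρ → Admissible M L C₆ δ fπ →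
      ∀ j : Fin k, ∃ R : (Fin ((j : ℕ) + 1) → ℂ) → ℂ,
        ExtendsLastPartial (transportComp (realRestr fρ) (realRestr fπ) j) R ∧
        DifferentiableOn ℂ R (nbhdBox fun i => C₇ * δ (Fin.castLE j.isLt i)) ∧
        (∀ z ∈ nbhdBox fun i => C₇ * δ (Fin.castLE j.isLt i),
          R z ∈ Metric.ball (1 : ℂ) C₈ ∧ 1 / C₈ ≤ (R z).re) ∧
        (1 ≤ (j : ℕ) →
          ∀ z ∈ nbhdBox fun i : Fin (j : ℕ) => C₇ * δ (Fin.castLE j.isLt.le i),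
          ∀ s ∈ realSeg, R (Fin.snoc z s) ∈ Metric.ball (1 : ℂ) (C₈ / δ j)) := by
  have hL : 0 < L := hM.trans_le hML
  have hm : M / L ≤ 1 := (div_le_one hL).2 hML
  have hΛ : 1 ≤ L / M := (one_le_div hM).2 hML
  obtain ⟨κ, hκ⟩ : ∃ κ, L / M / (M / L) = κ := ⟨_, rfl⟩
  have hκ_ge : 1 ≤ κ := hκ ▸ (one_le_div (by positivity)).2 (hm.trans hΛ)
  have hc : L / M * (M / L / (32 * (L / M))) ≤ M / L / 32 := by field_simp; rfl
  refine ⟨min 1 (M ^ 3 / (256 * L ^ 2)), M / L / (32 * (L / M)), 97 * κ + 8 * κ ^ 2,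
    by positivity, min_le_left _ _, by positivity, div_le_one_of_le₀ (by linarith) (by positivity),
    by positivity, fun k δ hδ fρ fπ hρ hπ j => ?_⟩
  obtain ⟨d, hd, rfl⟩ := exists_pos_seq_extending hδ
  have hf := hρ.holomorphicDisintegration hM (min_le_right _ _) hd
  have hg := hπ.holomorphicDisintegration hM (min_le_right _ _) hd
  refine ⟨transportDeriv d _ _ j, hf.extendsLastPartial_transportDeriv hg hc (by positivity) j.2,
    hf.differentiableOn_transportDeriv hg hc j.2, fun z hz => ⟨?_, ?_⟩, fun _ z hz s hs => ?_⟩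
  · have hbound := hκ ▸ hf.norm_transportDeriv_le hg hc j.2 hz
    exact mem_ball_iff_norm.2 ((norm_sub_le _ _).trans_lt (by rw [norm_one]; nlinarith))
  · refine le_trans ?_ (hκ ▸ hf.le_re_transportDeriv hg hc j.2 hz)
    exact one_div_le_one_div_of_le (by positivity) (by linarith)
  · refine mem_ball_iff_norm.2 (LE.le.trans_lt
      (hκ ▸ hf.norm_transportDeriv_snoc_sub_one_le hg hc (by positivity) j.2 hz hs) ?_)
    exact div_lt_div_of_pos_right (by nlinarith) (hd j)
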